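/- Let $(R,\mathfrak m)$ be a commutative Noetherian local ring and let $M$ be a finitely generated $R$-module of Krull dimension $\dim M=d\ge 1$. The dimension filtration of $M$ is the unique filtration $\mathcal D:\ H^0_{\mathfrak m}(M)=D_0\subset D_1\subset\cdots\subset D_t=M$ by submodules such that, for $i=1,\dots,t$, $D_{i-1}$ is the largest submodule of $D_i$ with $\dim D_{i-1}<\dim D_i$; here $H^0_{\mathfrak m}(M)$ is the submodule of elements annihilated by some power of $\mathfrak m$, and the zero module has dimension $-\infty$. Put $d_i=\dim D_i$. The module $M$ is called sequentially Cohen–Macaulay if $D_i/D_{i-1}$ is Cohen–Macaulay for all $i=1,\dots,t$. A system of parameters of $M$ is a sequence $\underline x=(x_1,\dots,x_d)$ of elements of $\mathfrak m$ such that $M/(x_1,\dots,x_d)M$ has finite length. It is called good if $D_i\cap (x_j : d_i<j\le d)M=0$ for all $i=0,\dots,t-1$. For $n\ge 1$ let $$\Lambda_{d,n}=\Big\{(\alpha_1,\dots,\alpha_d)\in\mathbb Z^d : \alpha_i\ge 1 \text{ for all } i,\ \sum_{i=1}^d\alpha_i=d+n-1\Big\}.$$ A system of parameters $\underline x$ of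 $M$, with $\mathfrak q=(x_1,\dots,x_d)$, has the property of parametric decomposition if $$\mathfrak q^nM=\bigcap_{\alpha\in\Lambda_{d,n}}(x_1^{\alpha_1},\dots,x_d^{\alpha_d})M\qquad\text{for all } n\ge 1.$$ Then the following statements are equivalent: (i) $M$ is a sequentially Cohen–Macaulay module. (ii) Every good system of parameters of $M$ has the property of parametric decomposition. (iii) There exists a good system of parameters of $M$ having the property of parametric decomposition. -/

import Mathlib

namespace SeqCM

universe u v

section

variable (R : Type u) [CommRing R] [IsLocalRing R]
variable (M : Type v) [AddCommGroup M] [Module R M]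

/-- The zeroth local cohomology module `H⁰_𝔪(M)`: the submodule of all elements of `M` that are
annihilated by some power of the maximal ideal. -/
def localH0 : Submodule R M where
  carrier := {m | ∃ k : ℕ, ∀ r ∈ IsLocalRing.maximalIdeal R ^ k, r • m = 0}
  zero_mem' := ⟨0, fun r _ => smul_zero r⟩
  add_mem' := by
    rintro a b ⟨k, hk⟩ ⟨l, hl⟩
    refine ⟨k + l, fun r hr => ?_⟩
    rw [smul_add, hk r (Ideal.pow_le_pow_right (Nat.le_add_right k l) hr),
      hl r (Ideal.pow_le_pow_right (Nat.le_add_left l k) hr), add_zero]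
  smul_mem' := by
    rintro c m ⟨k, hk⟩
    exact ⟨k, fun r hr => by rw [smul_comm, hk r hr, smul_zero]⟩

/-- The depth of `M`: the supremum of the lengths of the `M`-regular sequences in the maximal
ideal. -/
noncomputable def depth : ℕ∞ :=
  ⨆ rs : {rs : List R // (∀ r ∈ rs, r ∈ IsLocalRing.maximalIdeal R) ∧
    RingTheory.Sequence.IsRegular M rs}, (rs.1.length : ℕ∞)

/-- `M` is Cohen–Macaulay: it is zero or its depth equals its dimension (for finitely generated
modules over a Noetherian local ring). -/
def IsCohenMacaulay : Prop :=
  Subsingleton M ∨ (depth R M : WithBot ℕ∞) = Module.supportDim R M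

variable {M}

/-- `D` is a dimension filtration `H⁰_𝔪(M) = D₀ ⊂ D₁ ⊂ ⋯ ⊂ D_t = M`: each `D_{i-1}` is the largest
submodule of `D_i` of dimension smaller than `dim D_i`. The zero module has dimension `⊥`. -/
structure IsDimensionFiltration {t : ℕ} (D : Fin (t + 1) → Submodule R M) : Prop where
  bottom : D 0 = localH0 R M
  top : D (Fin.last t) = ⊤
  step : ∀ i : Fin t, IsGreatest
    {N : Submodule R M | N ≤ D i.succ ∧ Module.supportDim R N < Module.supportDim R (D i.succ)}
    (D i.castSucc)

variable (M)

/-- `M` is sequentially Cohen–Macaulay: the successive quotients `D_i / D_{i-1}` of its dimension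
filtration are Cohen–Macaulay. -/
def IsSequentiallyCohenMacaulay : Prop :=
  ∃ (t : ℕ) (D : Fin (t + 1) → Submodule R M), IsDimensionFiltration R D ∧
    ∀ i : Fin t, IsCohenMacaulay R (D i.succ ⧸ (D i.castSucc).submoduleOf (D i.succ))

variable {R} {d : ℕ}

/-- `x₁, …, x_d` is a system of parameters of `M`: `d = dim M`, all `x_i` lie in the maximal ideal
and `M / (x₁, …, x_d) M` has finite length. -/
structure IsSystemOfParameters (x : Fin d → R) : Prop where
  dim_eq : Module.supportDim R M = d
  mem : ∀ i, x i ∈ IsLocalRing.maximalIdeal R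
  finiteLength : IsFiniteLength R (M ⧸ Ideal.span (Set.range x) • (⊤ : Submodule R M))

/-- `x₁, …, x_d` is a good system of parameters of `M`: a system of parameters such that
`D_i ∩ (x_{d_i + 1}, …, x_d) M = 0` for `i = 0, …, t - 1`, where `D` is the dimension filtration of
`M` and `d_i = dim D_i`. Since `Fin d` counts from `0`, the element `x_j` of the text is `x (j - 1)`,
and the condition `j ≥ d_i + 1` becomes `dim D_i ≤ j`. -/
def IsGoodSystemOfParameters (x : Fin d → R) : Prop :=
  IsSystemOfParameters M x ∧
    ∃ (t : ℕ) (D : Fin (t + 1) → Submodule R M), IsDimensionFiltration R D ∧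
      ∀ i : Fin t, D i.castSucc ⊓
        Ideal.span (x '' {j : Fin d | Module.supportDim R (D i.castSucc) ≤ ((j : ℕ) : WithBot ℕ∞)}) •
          (⊤ : Submodule R M) = ⊥

end

/-- `Λ_{d,n}`: the tuples `(α₁, …, α_d)` of positive integers with `α₁ + ⋯ + α_d = d + n - 1`. -/
def Lambda (d n : ℕ) : Set (Fin d → ℕ) :=
  {α | (∀ i, 1 ≤ α i) ∧ ∑ i, α i + 1 = d + n}

/-- The property of parametric decomposition: with `𝔮 = (x₁, …, x_d)`, the equality
`𝔮ⁿ M = ⋂_{α ∈ Λ_{d,n}} (x₁ ^ α₁, …, x_d ^ α_d) M` holds for all `n ≥ 1`. -/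
def HasParametricDecomposition {R : Type u} [CommRing R] (M : Type v) [AddCommGroup M] [Module R M]
    {d : ℕ} (x : Fin d → R) : Prop :=
  ∀ n : ℕ, 1 ≤ n →
    Ideal.span (Set.range x) ^ n • (⊤ : Submodule R M) =
      ⨅ α ∈ Lambda d n, Ideal.span (Set.range fun i => x i ^ α i) • (⊤ : Submodule R M)

end SeqCM

/-! The argument climbs or descends the dimension filtration one step N = D_{i-1} ≤ D = D_i at a
time, with parametric decomposition formulated for submodules (`ParametricOn`). Goodness of x forces
x_j D = 0 for j > dim D, and such x_j may be discarded (`parametricOn_subtype_iff`). The remaining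
ones are parameters of D, and the last of them kills N because dim N < dim D.

Suppose D/N is Cohen–Macaulay. Then positive powers of the parameters, in any order, are regular on
D/N. Hence (x^α)D ∩ N = (x^α)N, and an element of every (x^α)D lies in 𝔮ⁿD + N; its N-part lies in
𝔮ⁿN by decomposition for N. So decomposition ascends (`ParametricOn.of_submodule`), starting from
D_0, which every x_j kills.

Conversely, suppose D has the decomposition. Maximality of N makes every associated prime of D/N
have dimension at least dim D, so each x_i is a nonzerodivisor on D/N. If x^β p ∈ (x_i^{β_i+1})D +
N, multiplying by the parameter that kills N removes the N-term. Decomposition then allows p to be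
changed by elements of 𝔮D until its monomial multiple is arbitrarily deep; Artin–Rees, cancellation
and Krull's theorem give p ∈ 𝔮D + N (`ParametricOn.quasiRegularMod`). This quasi-regularity yields
regularity, so D/N is Cohen–Macaulay, and also 𝔮ⁿD ∩ N = 𝔮ⁿN, so decomposition descends to N.

Good systems exist by prime avoidance inside high powers of the annihilators of the D_i
(`exists_isGoodSystemOfParameters`). -/

namespace SeqCM

/-! ### Monomials and ideals of powers. -/

section Monomials

variable {R : Type*} [CommRing R] {M : Type*} [AddCommGroup M] [Module R M] {ι : Type*}

/-- The ideal generated by the powers `x j ^ α j` with `j ∈ T`. -/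
def powIdeal (x : ι → R) (α : ι → ℕ) (T : Set ι) : Ideal R :=
  Ideal.span ((fun j => x j ^ α j) '' T)

/-- The property of parametric decomposition for a submodule, without the trivial inclusion. -/
def ParametricOn [Fintype ι] (x : ι → R) (D : Submodule R M) : Prop :=
  ∀ n : ℕ, 1 ≤ n → ∀ p : M,
    (∀ α : ι → ℕ, (∀ i, 1 ≤ α i) → ∑ i, α i + 1 = Fintype.card ι + n →
      p ∈ powIdeal x α Set.univ • D) →
    p ∈ Ideal.span (Set.range x) ^ n • D

/-- On `D / N`, each `x i` is a nonzerodivisor modulo any positive powers of other entries. -/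
def RegularMod (x : ι → R) (D N : Submodule R M) : Prop :=
  ∀ (T : Set ι) (i : ι), i ∉ T → ∀ α : ι → ℕ, (∀ j, 1 ≤ α j) → ∀ p ∈ D,
    x i • p ∈ powIdeal x α T • D ⊔ N → p ∈ powIdeal x α T • D ⊔ N

/-- A monomial form of quasi-regularity of `x` on `D / N`. -/
def QuasiRegularMod [Fintype ι] (x : ι → R) (D N : Submodule R M) : Prop :=
  ∀ β : ι → ℕ, ∀ p ∈ D, (∏ i, x i ^ β i) • p ∈ powIdeal x (fun i => β i + 1) Set.univ • D ⊔ N →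
    p ∈ Ideal.span (Set.range x) • D ⊔ N

/-- The span of the elements `x ^ β • m` with `β ∈ A` and `m ∈ D`. -/
def monomialSpan [Fintype ι] (x : ι → R) (D : Submodule R M) (A : Set (ι → ℕ)) : Submodule R M :=
  Submodule.span R {z | ∃ β ∈ A, ∃ m ∈ D, z = (∏ i, x i ^ β i) • m}

theorem pow_mem_powIdeal (x : ι → R) (α : ι → ℕ) {T : Set ι} {i : ι} (hi : i ∈ T) :
    x i ^ α i ∈ powIdeal x α T :=
  Ideal.subset_span ⟨i, hi, rfl⟩

theorem powIdeal_mono (x : ι → R) (α : ι → ℕ) {S T : Set ι} (h : S ⊆ T) :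
    powIdeal x α S ≤ powIdeal x α T :=
  Ideal.span_mono (Set.image_mono h)

theorem powIdeal_le_of_le (x : ι → R) {α β : ι → ℕ} {S : Set ι} (h : ∀ i ∈ S, α i ≤ β i) :
    powIdeal x β S ≤ powIdeal x α S := by
  refine Ideal.span_le.2 ?_
  rintro _ ⟨i, hi, rfl⟩
  exact Ideal.mem_of_dvd _ (pow_dvd_pow _ (h i hi)) (pow_mem_powIdeal x α hi)

theorem powIdeal_congr (x : ι → R) {α β : ι → ℕ} {S : Set ι} (h : ∀ i ∈ S, α i = β i) :
    powIdeal x α S = powIdeal x β S :=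
  le_antisymm (powIdeal_le_of_le x fun i hi => (h i hi).ge)
    (powIdeal_le_of_le x fun i hi => (h i hi).le)

theorem powIdeal_insert (x : ι → R) (α : ι → ℕ) (i : ι) (T : Set ι) :
    powIdeal x α (insert i T) = Ideal.span {x i ^ α i} ⊔ powIdeal x α T := by
  rw [powIdeal, powIdeal, Set.image_insert_eq, Ideal.span_insert]

theorem powIdeal_univ_one (x : ι → R) :
    powIdeal x (fun _ => 1) Set.univ = Ideal.span (Set.range x) := by
  simp [powIdeal]

theorem mem_powIdeal_insert_smul {x : ι → R} {α : ι → ℕ} {i : ι} {T : Set ι}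
    {D : Submodule R M} {p : M} (h : p ∈ powIdeal x α (insert i T) • D) :
    ∃ m ∈ D, ∃ v ∈ powIdeal x α T • D, p = x i ^ α i • m + v := by
  rw [powIdeal_insert, Submodule.sup_smul] at h
  obtain ⟨a, ha, v, hv, rfl⟩ := Submodule.mem_sup.1 h
  rw [Submodule.ideal_span_singleton_smul] at ha
  obtain ⟨m, hm, rfl⟩ := (Submodule.mem_smul_pointwise_iff_exists _ _ _).1 ha
  exact ⟨m, hm, v, hv, rfl⟩

variable [Fintype ι]

theorem monomial_mem_powIdeal (x : ι → R) {α γ : ι → ℕ} {T : Set ι} {i : ι} (hi : i ∈ T)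
    (h : α i ≤ γ i) : ∏ j, x j ^ γ j ∈ powIdeal x α T :=
  Ideal.mem_of_dvd _
    ((pow_dvd_pow _ h).trans (Finset.dvd_prod_of_mem (fun j => x j ^ γ j) (Finset.mem_univ i)))
    (pow_mem_powIdeal x α hi)

theorem monomial_mem_pow {I : Ideal R} {x : ι → R} (hx : ∀ i, x i ∈ I) {γ : ι → ℕ} {n : ℕ}
    (h : n ≤ ∑ i, γ i) : ∏ j, x j ^ γ j ∈ I ^ n := by
  refine Ideal.pow_le_pow_right h ?_
  rw [← Finset.prod_pow_eq_pow_sum]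
  exact Ideal.prod_mem_prod fun i _ => Ideal.pow_mem_pow (hx i) _

theorem monomialSpan_le {x : ι → R} {D : Submodule R M} {A : Set (ι → ℕ)} {P : Submodule R M}
    (h : ∀ β ∈ A, ∀ m ∈ D, (∏ i, x i ^ β i) • m ∈ P) : monomialSpan x D A ≤ P := by
  refine Submodule.span_le.2 ?_
  rintro _ ⟨β, hβ, m, hm, rfl⟩
  exact h β hβ m hm

theorem mem_monomialSpan (x : ι → R) {D : Submodule R M} {A : Set (ι → ℕ)} {β : ι → ℕ}
    (hβ : β ∈ A) {m : M} (hm : m ∈ D) : (∏ i, x i ^ β i) • m ∈ monomialSpan x D A :=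
  Submodule.subset_span ⟨β, hβ, m, hm, rfl⟩

theorem monomial_add (x : ι → R) (β γ : ι → ℕ) :
    ∏ i, x i ^ (β i + γ i) = (∏ i, x i ^ β i) * ∏ i, x i ^ γ i := by
  simp [pow_add, Finset.prod_mul_distrib]

theorem monomial_single [DecidableEq ι] (x : ι → R) (i : ι) (b : ℕ) :
    ∏ j, x j ^ (Pi.single i b : ι → ℕ) j = x i ^ b := by
  rw [Finset.prod_eq_single i]
  · simp
  · intro j _ hj; simp [hj]
  · simp

theorem span_pow_smul_le_monomialSpan (x : ι → R) (D : Submodule R M) (n : ℕ) :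
    Ideal.span (Set.range x) ^ n • D ≤ monomialSpan x D {β | ∑ i, β i = n} := by
  classical
  induction n with
  | zero =>
    intro p hp
    have := mem_monomialSpan x (A := {β | ∑ i, β i = 0}) (β := 0) (by simp) (m := p)
      (by simpa using hp)
    simpa using this
  | succ n ih =>
    rw [pow_succ', mul_smul]
    refine (Submodule.smul_mono le_rfl ih).trans ?_
    rw [Ideal.span, monomialSpan, Submodule.span_smul_span]
    refine Submodule.span_le.2 ?_
    rintro _ ⟨_, ⟨i, rfl⟩, _, ⟨β, hβ, m, hm, rfl⟩, rfl⟩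
    have hsum : ∑ j, (Pi.single i 1 : ι → ℕ) j = 1 := by simp
    have := mem_monomialSpan x (A := {β | ∑ i, β i = n + 1})
      (β := fun j => (Pi.single i 1 : ι → ℕ) j + β j)
      (by
        simp only [Set.mem_ofPred_eq] at hβ ⊢
        rw [Finset.sum_add_distrib, hβ, hsum, add_comm]) hm
    rw [monomial_add, monomial_single, pow_one, mul_smul] at this
    exact this

theorem exists_sum_of_mem_monomialSpan {x : ι → R} {D : Submodule R M} {F : Finset (ι → ℕ)}
    {p : M} (h : p ∈ monomialSpan x D F) :
    ∃ f : (ι → ℕ) → M, (∀ β, f β ∈ D) ∧ p = ∑ β ∈ F, (∏ i, x i ^ β i) • f β := by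
  classical
  induction h using Submodule.span_induction with
  | mem z hz =>
    obtain ⟨β, hβ, m, hm, rfl⟩ := hz
    refine ⟨Pi.single β m, fun γ => ?_, ?_⟩
    · by_cases hγ : γ = β
      · subst hγ; simpa using hm
      · simp [hγ]
    · rw [Finset.sum_eq_single β]
      · simp
      · intro γ _ hγ; simp [hγ]
      · intro h; exact absurd hβ h
  | zero => exact ⟨0, fun _ => D.zero_mem, by simp⟩
  | add y z _ _ hy hz =>
    obtain ⟨f, hf, rfl⟩ := hy
    obtain ⟨g, hg, rfl⟩ := hz
    exact ⟨f + g, fun β => D.add_mem (hf β) (hg β), by simp [Finset.sum_add_distrib]⟩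
  | smul r y _ hy =>
    obtain ⟨f, hf, rfl⟩ := hy
    exact ⟨r • f, fun β => D.smul_mem _ (hf β), by
      simp only [Finset.smul_sum, Pi.smul_apply]
      exact Finset.sum_congr rfl fun β _ => smul_comm _ _ _⟩

theorem exists_sum_of_mem_span_pow_smul {x : ι → R} {D : Submodule R M} {n : ℕ} {p : M}
    (h : p ∈ Ideal.span (Set.range x) ^ n • D) :
    ∃ F : Finset (ι → ℕ), (∀ β ∈ F, ∑ i, β i = n) ∧ ∃ f : (ι → ℕ) → M, (∀ β, f β ∈ D) ∧
      p = ∑ β ∈ F, (∏ i, x i ^ β i) • f β := by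
  classical
  refine ⟨Finset.piAntidiag Finset.univ n, fun β hβ => (Finset.mem_piAntidiag.1 hβ).1,
    exists_sum_of_mem_monomialSpan ?_⟩
  convert! span_pow_smul_le_monomialSpan x D n h using 2
  ext β
  simp

/-- Pigeonhole: if α_i > β_i for all i, then |α| ≥ |β| + card ι, one more than allowed. This is the
trivial inclusion that `ParametricOn` leaves out. -/
theorem span_pow_smul_le_powIdeal_smul (x : ι → R) (D : Submodule R M) {n : ℕ}
    {α : ι → ℕ} (hα : ∑ i, α i + 1 = Fintype.card ι + n) :
    Ideal.span (Set.range x) ^ n • D ≤ powIdeal x α Set.univ • D := by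
  refine (span_pow_smul_le_monomialSpan x D n).trans (monomialSpan_le fun β hβ m hm => ?_)
  obtain ⟨i, hi⟩ : ∃ i, α i ≤ β i := by
    by_contra! hcon
    have : ∑ i, (β i + 1) ≤ ∑ i, α i := Finset.sum_le_sum fun i _ => hcon i
    have hβ' : ∑ i, β i = n := hβ
    simp only [Finset.sum_add_distrib, hβ', Finset.sum_const, Finset.card_univ, smul_eq_mul,
      mul_one] at this
    omega
  exact Submodule.smul_mem_smul (monomial_mem_powIdeal x (Set.mem_univ i) hi) hm

end Monomials

/-! ### Krull intersection and Artin–Rees. -/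

section Krull

variable {R : Type*} [CommRing R] [IsLocalRing R] [IsNoetherianRing R]
  {M : Type*} [AddCommGroup M] [Module R M] [Module.Finite R M]

open IsLocalRing

/-- Krull's intersection theorem on M/W: W is closed in the 𝔪-adic topology. It finishes every
approximation argument below. -/
theorem mem_of_forall_mem_sup_maximalIdeal_pow {W : Submodule R M} {p : M}
    (h : ∀ k : ℕ, p ∈ W ⊔ maximalIdeal R ^ k • (⊤ : Submodule R M)) : p ∈ W := by
  have hk := Ideal.iInf_pow_smul_eq_bot_of_isLocalRing (M := M ⧸ W) (maximalIdeal R)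
    (Ideal.IsPrime.ne_top inferInstance)
  have : W.mkQ p ∈ (⨅ i : ℕ, maximalIdeal R ^ i • ⊤ : Submodule R (M ⧸ W)) := by
    refine Submodule.mem_iInf _ |>.2 fun k => ?_
    have h1 := Submodule.mem_map_of_mem (f := W.mkQ) (h k)
    rw [Submodule.map_sup, Submodule.mkQ_map_self, bot_sup_eq, Submodule.map_smul''] at h1
    exact Submodule.smul_mono le_rfl le_top h1
  rw [hk] at this
  simpa using this

theorem exists_maximalIdeal_pow_smul_inf_le (N : Submodule R M) :
    ∃ c : ℕ, ∀ k : ℕ, maximalIdeal R ^ (k + c) • (⊤ : Submodule R M) ⊓ N ≤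
      maximalIdeal R ^ k • N := by
  obtain ⟨c, hc⟩ := Ideal.exists_pow_inf_eq_pow_smul (maximalIdeal R) N
  refine ⟨c, fun k => ?_⟩
  rw [hc (k + c) (Nat.le_add_left _ _), Nat.add_sub_cancel]
  exact Submodule.smul_mono le_rfl inf_le_right

end Krull

end SeqCM

namespace SeqCM

/-! ### Raising the excess of a monomial expression. -/

section Excess

variable {R : Type*} [CommRing R] {M : Type*} [AddCommGroup M] [Module R M] {ι : Type*} [Fintype ι]

/-- Truncated subtraction makes ∑ (γ_i - β_i) the excess of γ over β. Excess at least r places x^β z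
in every (x^α)D with |α| = card ι + |β| + r - 1, so decomposition rewrites it with monomials of
degree |β| + r. Those divisible by x^β are absorbed into u; all others have larger excess. -/
theorem ParametricOn.exists_sub_mem_monomialSpan_succ {x : ι → R} {D : Submodule R M}
    (h : ParametricOn x D) {β : ι → ℕ} {r : ℕ} (hr : 1 ≤ r) {z : M} (hz : z ∈ D)
    (hJ : (∏ i, x i ^ β i) • z ∈ monomialSpan x D {γ | r ≤ ∑ i, (γ i - β i)}) :
    ∃ u ∈ Ideal.span (Set.range x) • D,
      (∏ i, x i ^ β i) • (z - u) ∈ monomialSpan x D {γ | r + 1 ≤ ∑ i, (γ i - β i)} := by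
  classical
  have hmem := h (∑ i, β i + r) (by omega) ((∏ i, x i ^ β i) • z) (by
    intro α _ hα
    by_cases hβ : ∃ i, α i ≤ β i
    · obtain ⟨i, hi⟩ := hβ
      exact Submodule.smul_mem_smul (monomial_mem_powIdeal x (Set.mem_univ i) hi) hz
    push Not at hβ
    refine monomialSpan_le (fun γ hγ m hm => ?_) hJ
    obtain ⟨i, hi⟩ : ∃ i, α i ≤ γ i := by
      by_contra! hcon
      have : ∑ i, ((γ i - β i) + β i + 1) ≤ ∑ i, α i :=
        Finset.sum_le_sum fun i _ => by have := hcon i; have := hβ i; omega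
      simp only [Finset.sum_add_distrib, Finset.sum_const, Finset.card_univ, smul_eq_mul,
        mul_one, Set.mem_ofPred_eq] at this hγ
      omega
    exact Submodule.smul_mem_smul (monomial_mem_powIdeal x (Set.mem_univ i) hi) hm)
  obtain ⟨F, hF, f, hf, hsum⟩ := exists_sum_of_mem_span_pow_smul hmem
  -- In degree |β| + r the excess is r plus the deficit, so it exceeds r unless x^β divides x^γ.
  have hexc : ∀ γ ∈ F, ∑ i, (γ i - β i) = r + ∑ i, (β i - γ i) := by
    intro γ hγ
    have h1 : ∑ i, (γ i - β i) + ∑ i, β i = ∑ i, (β i - γ i) + ∑ i, γ i := by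
      rw [← Finset.sum_add_distrib, ← Finset.sum_add_distrib]
      exact Finset.sum_congr rfl fun i _ => by omega
    have := hF γ hγ
    omega
  refine ⟨∑ γ ∈ F with ∀ i, β i ≤ γ i, (∏ i, x i ^ (γ i - β i)) • f γ, ?_, ?_⟩
  · refine Submodule.sum_mem _ fun γ hγ => Submodule.smul_mem_smul ?_ (hf γ)
    obtain ⟨hγF, _⟩ := Finset.mem_filter.1 hγ
    have := monomial_mem_pow (I := Ideal.span (Set.range x)) (x := x)
      (fun i => Ideal.subset_span ⟨i, rfl⟩) (γ := fun i => γ i - β i) (n := 1)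
      (by rw [hexc γ hγF]; omega)
    simpa using this
  · have hsplit : (∏ i, x i ^ β i) • ∑ γ ∈ F with ∀ i, β i ≤ γ i,
        (∏ i, x i ^ (γ i - β i)) • f γ =
        ∑ γ ∈ F with ∀ i, β i ≤ γ i, (∏ i, x i ^ γ i) • f γ := by
      rw [Finset.smul_sum]
      refine Finset.sum_congr rfl fun γ hγ => ?_
      rw [smul_smul, ← monomial_add]
      congr 1
      exact Finset.prod_congr rfl fun i _ => by
        rw [Nat.add_sub_cancel' ((Finset.mem_filter.1 hγ).2 i)]
    rw [smul_sub, hsplit, hsum, ← Finset.sum_filter_add_sum_filter_not F (fun γ => ∀ i, β i ≤ γ i),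
      add_sub_cancel_left]
    refine Submodule.sum_mem _ fun γ hγ => mem_monomialSpan x ?_ (hf γ)
    obtain ⟨hγF, hγ⟩ := Finset.mem_filter.1 hγ
    push Not at hγ
    obtain ⟨i, hi⟩ := hγ
    have : 1 ≤ ∑ i, (β i - γ i) :=
      le_trans (by omega) (Finset.single_le_sum (f := fun i => β i - γ i)
        (fun _ _ => Nat.zero_le _) (Finset.mem_univ i))
    have := hexc γ hγF
    simp only [Set.mem_ofPred_eq]
    omega

theorem ParametricOn.exists_sub_mem_monomialSpan {x : ι → R} {D : Submodule R M}
    (h : ParametricOn x D) {β : ι → ℕ} {p : M} (hp : p ∈ D)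
    (hJ : (∏ i, x i ^ β i) • p ∈ monomialSpan x D {γ | 1 ≤ ∑ i, (γ i - β i)}) (r : ℕ) :
    ∃ u ∈ Ideal.span (Set.range x) • D,
      (∏ i, x i ^ β i) • (p - u) ∈ monomialSpan x D {γ | r + 1 ≤ ∑ i, (γ i - β i)} := by
  induction r with
  | zero => exact ⟨0, zero_mem _, by simpa using hJ⟩
  | succ r ih =>
    obtain ⟨u, hu, hu'⟩ := ih
    obtain ⟨v, hv, hv'⟩ := h.exists_sub_mem_monomialSpan_succ (by omega)
      (D.sub_mem hp (Submodule.smul_le_right hu)) hu'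
    exact ⟨u + v, add_mem hu hv, by rwa [← sub_sub]⟩

end Excess

/-! ### From decomposition to quasi-regularity and regularity. -/

section Local

variable {R : Type*} [CommRing R] [IsLocalRing R] [IsNoetherianRing R]
  {M : Type*} [AddCommGroup M] [Module R M] [Module.Finite R M] {ι : Type*} [Fintype ι]
  {x : ι → R} {D N : Submodule R M}

open IsLocalRing
open scoped Pointwise

omit [IsLocalRing R] [IsNoetherianRing R] [Module.Finite R M] in
theorem mem_of_monomial_smul_mem (hreg : ∀ i, ∀ p ∈ D, x i • p ∈ N → p ∈ N) (β : ι → ℕ) {p : M}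
    (hp : p ∈ D) (h : (∏ i, x i ^ β i) • p ∈ N) : p ∈ N := by
  classical
  have hpow : ∀ i (b : ℕ), ∀ p ∈ D, x i ^ b • p ∈ N → p ∈ N := by
    intro i b
    induction b with
    | zero => intro p _ h; simpa using h
    | succ b ih =>
      intro p hp h
      rw [pow_succ', mul_smul] at h
      exact ih p hp (hreg i _ (D.smul_mem _ hp) h)
  suffices ∀ s : Finset ι, ∀ p ∈ D, (∏ i ∈ s, x i ^ β i) • p ∈ N → p ∈ N from this _ p hp h
  intro s
  induction s using Finset.induction_on with
  | empty => intro p _ h; simpa using h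
  | insert i s hi ih =>
    intro p hp h
    rw [Finset.prod_insert hi, mul_smul] at h
    exact ih p hp (hpow i _ _ (D.smul_mem _ hp) h)

/-- Parametric decomposition forces quasi-regularity modulo a submodule killed by one of the
elements, provided that all of them are nonzerodivisors on the quotient. -/
theorem ParametricOn.quasiRegularMod (h : ParametricOn x D) (hx : ∀ i, x i ∈ maximalIdeal R)
    {j : ι} (hj : ∀ n ∈ N, x j • n = 0)
    (hreg : ∀ i, ∀ p ∈ D, x i • p ∈ N → p ∈ N) : QuasiRegularMod x D N := by
  classical
  intro β p hp hβ
  -- The extra factor x_j kills the N-term, turning the hypothesis modulo N into a genuine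
  -- expression of excess at least 1 over β'.
  set β' : ι → ℕ := fun i => β i + (Pi.single j 1 : ι → ℕ) i with hβ'
  have hmono : ∏ i, x i ^ β' i = x j * ∏ i, x i ^ β i := by
    rw [hβ', monomial_add, monomial_single, pow_one, mul_comm]
  have hJ : (∏ i, x i ^ β' i) • p ∈ monomialSpan x D {γ | 1 ≤ ∑ i, (γ i - β' i)} := by
    obtain ⟨a, ha, n, hn, han⟩ := Submodule.mem_sup.1 hβ
    rw [hmono, mul_smul, ← han, smul_add, hj n hn, add_zero]
    clear han
    rw [powIdeal] at ha
    induction ha using Submodule.smul_induction_on' with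
    | smul r hr m hm =>
      induction hr using Submodule.span_induction with
      | mem r hr =>
        obtain ⟨i, -, rfl⟩ := hr
        have := mem_monomialSpan x (A := {γ | 1 ≤ ∑ i, (γ i - β' i)})
          (β := fun k => (Pi.single j 1 : ι → ℕ) k + (Pi.single i (β i + 1) : ι → ℕ) k) (by
            refine le_trans ?_ (Finset.single_le_sum (fun _ _ => Nat.zero_le _) (Finset.mem_univ i))
            simp only [hβ', Pi.single_eq_same]; omega) hm
        rwa [monomial_add, monomial_single, monomial_single, pow_one, mul_smul] at this
      | zero => simp
      | add y z _ _ hy hz => rw [add_smul, smul_add]; exact add_mem hy hz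
      | smul s y _ hy =>
        rw [smul_eq_mul, mul_smul, smul_comm]; exact Submodule.smul_mem _ _ hy
    | add y _ z _ hy hz => rw [smul_add]; exact add_mem hy hz
  set y := ∏ i, x i ^ β' i with hy
  have hW : Ideal.span (Set.range x) • D ≤ D := Submodule.smul_le_right
  -- Artin–Rees for yD + N converts depth of y(p - u) in M into y(p - u) ∈ y𝔪^k D + N. Cancelling y
  -- modulo N leaves p ∈ 𝔮D + N + 𝔪^k M.
  obtain ⟨c, hc⟩ := exists_maximalIdeal_pow_smul_inf_le (y • D ⊔ N)
  refine mem_of_forall_mem_sup_maximalIdeal_pow fun k => ?_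
  obtain ⟨u, hu, hu'⟩ := h.exists_sub_mem_monomialSpan hp hJ (k + c)
  have hm : y • (p - u) ∈ maximalIdeal R ^ (k + c) • (⊤ : Submodule R M) := by
    refine monomialSpan_le (fun γ hγ m _ => Submodule.smul_mem_smul ?_ Submodule.mem_top) hu'
    refine monomial_mem_pow hx ?_
    have : ∑ i, (γ i - β' i) ≤ ∑ i, γ i := Finset.sum_le_sum fun i _ => Nat.sub_le _ _
    simp only [Set.mem_ofPred_eq] at hγ
    omega
  have hpu : p - u ∈ D := D.sub_mem hp (hW hu)
  have := hc k ⟨hm, Submodule.mem_sup_left (Submodule.smul_mem_pointwise_smul _ _ _ hpu)⟩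
  rw [Submodule.smul_sup, ← Submodule.ideal_span_singleton_smul, ← mul_smul, mul_comm, mul_smul,
    Submodule.ideal_span_singleton_smul] at this
  obtain ⟨a, ha, n, hn, han⟩ := Submodule.mem_sup.1 this
  obtain ⟨w, hw, rfl⟩ := (Submodule.mem_smul_pointwise_iff_exists _ _ _).1 ha
  have hwD : w ∈ D := Submodule.smul_le_right hw
  have hN : p - u - w ∈ N := by
    refine mem_of_monomial_smul_mem hreg β' (D.sub_mem hpu hwD) ?_
    rw [smul_sub, ← hy, ← han, add_sub_cancel_left]
    exact Submodule.smul_le_right hn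
  have : p = u + (p - u - w) + w := by abel
  rw [this]
  exact add_mem (Submodule.mem_sup_left (add_mem (Submodule.mem_sup_left hu)
    (Submodule.mem_sup_right hN))) (Submodule.mem_sup_right (Submodule.smul_mono le_rfl le_top hw))

/-- The error of p modulo V + N is pushed into ever higher 𝔮ⁿD. A degree-n term outside V has its
coefficient isolated after multiplication by x_i, and quasi-regularity places that coefficient in 𝔮D
+ N. -/
theorem QuasiRegularMod.regularMod (h : QuasiRegularMod x D N) (hx : ∀ i, x i ∈ maximalIdeal R) :
    RegularMod x D N := by
  classical
  intro T i hi α _ p hp hxp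
  set V := powIdeal x α T • D with hV
  have key : ∀ n : ℕ, p ∈ V ⊔ N ⊔ Ideal.span (Set.range x) ^ n • D := by
    intro n
    induction n with
    | zero => exact Submodule.mem_sup_right (by simpa using hp)
    | succ n ih =>
      obtain ⟨w, hw, s, hs, rfl⟩ := Submodule.mem_sup.1 ih
      obtain ⟨F, hF, f, hf, rfl⟩ := exists_sum_of_mem_span_pow_smul hs
      refine add_mem (Submodule.mem_sup_left hw) (Submodule.sum_mem _ fun β hβ => ?_)
      by_cases hT : ∃ j ∈ T, α j ≤ β j
      · obtain ⟨j, hj, hjβ⟩ := hT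
        exact Submodule.mem_sup_left (Submodule.mem_sup_left
          (Submodule.smul_mem_smul (monomial_mem_powIdeal x hj hjβ) (hf β)))
      push Not at hT
      set β' : ι → ℕ := fun k => (Pi.single i 1 : ι → ℕ) k + β k with hβ'
      have hmono : ∀ γ : ι → ℕ, x i * ∏ k, x k ^ γ k =
          ∏ k, x k ^ ((Pi.single i 1 : ι → ℕ) k + γ k) := by
        intro γ
        rw [monomial_add, monomial_single, pow_one]
      -- Since α_j > β_j on T and i ∉ T, each generator x_j^{α_j} is divisible by x_j^{β'_j+1}.
      have hVle : V ≤ powIdeal x (fun k => β' k + 1) Set.univ • D := by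
        refine Submodule.smul_mono_left (le_trans (powIdeal_le_of_le x fun j hj => ?_)
          (powIdeal_mono x _ (Set.subset_univ T)))
        have := hT j hj
        have hji : j ≠ i := fun h => hi (h ▸ hj)
        simp only [hβ', Pi.single_apply, hji, if_false]
        omega
      have hfβ : f β ∈ Ideal.span (Set.range x) • D ⊔ N := by
        refine h β' (f β) (hf β) ?_
        rw [← hmono, mul_smul]
        have hsum : x i • (∏ k, x k ^ β k) • f β = x i • (w + ∑ γ ∈ F, (∏ k, x k ^ γ k) • f γ)
            - x i • w - ∑ γ ∈ F.erase β, x i • (∏ k, x k ^ γ k) • f γ := by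
          rw [← Finset.add_sum_erase F _ hβ, ← Finset.smul_sum]
          simp only [smul_add]
          abel
        have hVN : V ⊔ N ≤ powIdeal x (fun k => β' k + 1) Set.univ • D ⊔ N :=
          sup_le_sup_right hVle N
        rw [hsum]
        refine sub_mem (sub_mem (hVN hxp) (hVN (Submodule.smul_mem _ _ hw)))
          (Submodule.sum_mem _ fun γ hγ => Submodule.mem_sup_left ?_)
        obtain ⟨hne, hγF⟩ := Finset.mem_erase.1 hγ
        rw [smul_smul, hmono]
        obtain ⟨k, hk⟩ : ∃ k, β k < γ k := by
          by_contra! hcon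
          refine hne (funext fun k => ?_)
          have hs : ∑ k, γ k = ∑ k, β k := by rw [hF γ hγF, hF β hβ]
          exact (Finset.sum_eq_sum_iff_of_le fun k _ => hcon k).1 hs k (Finset.mem_univ k)
        exact Submodule.smul_mem_smul
          (monomial_mem_powIdeal x (Set.mem_univ k) (by simp only [hβ']; omega)) (hf γ)
      have hmem : ∏ k, x k ^ β k ∈ Ideal.span (Set.range x) ^ n :=
        monomial_mem_pow (I := Ideal.span (Set.range x)) (x := x)
          (fun k => Ideal.subset_span ⟨k, rfl⟩) (hF β hβ).ge
      obtain ⟨a, ha, b, hb, hab⟩ := Submodule.mem_sup.1 hfβ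
      rw [← hab, smul_add]
      refine add_mem (Submodule.mem_sup_right ?_)
        (Submodule.mem_sup_left (Submodule.mem_sup_right (N.smul_mem _ hb)))
      rw [pow_succ, mul_smul]
      exact Submodule.smul_mem_smul hmem ha
  refine mem_of_forall_mem_sup_maximalIdeal_pow fun k => ?_
  have hqm : Ideal.span (Set.range x) ≤ maximalIdeal R := by
    refine Ideal.span_le.2 ?_
    rintro _ ⟨i, rfl⟩
    exact hx i
  have hle : V ⊔ N ⊔ Ideal.span (Set.range x) ^ k • D ≤
      V ⊔ N ⊔ maximalIdeal R ^ k • (⊤ : Submodule R M) :=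
    sup_le_sup_left (Submodule.smul_mono (Ideal.pow_right_mono hqm k) le_top) _
  exact hle (key k)

/-- Quasi-regularity puts the coefficients of an element of 𝔮ⁿD ∩ N in 𝔮D + N. Splitting off their
N-parts leaves a remainder in 𝔮ⁿ⁺¹D ∩ N; iterating, Artin–Rees and Krull remove it. -/
theorem QuasiRegularMod.span_pow_smul_inf_le (h : QuasiRegularMod x D N)
    (hx : ∀ i, x i ∈ maximalIdeal R) (n : ℕ) :
    Ideal.span (Set.range x) ^ n • D ⊓ N ≤ Ideal.span (Set.range x) ^ n • N := by
  classical
  set q := Ideal.span (Set.range x) with hq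
  have hqm : q ≤ maximalIdeal R := by
    refine Ideal.span_le.2 ?_
    rintro _ ⟨i, rfl⟩
    exact hx i
  have step : ∀ n, q ^ n • D ⊓ N ≤ q ^ n • N ⊔ (q ^ (n + 1) • D ⊓ N) := by
    rintro n z ⟨hz, hzN⟩
    obtain ⟨F, hF, f, hf, rfl⟩ := exists_sum_of_mem_span_pow_smul hz
    have hfq : ∀ β ∈ F, ∃ a ∈ q • D, ∃ b ∈ N, a + b = f β := by
      intro β hβ
      refine Submodule.mem_sup.1 (h β (f β) (hf β) ?_)
      rw [eq_sub_of_add_eq (Finset.add_sum_erase F (fun γ => (∏ k, x k ^ γ k) • f γ) hβ)]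
      refine sub_mem (Submodule.mem_sup_right hzN)
        (Submodule.sum_mem _ fun γ hγ => Submodule.mem_sup_left ?_)
      obtain ⟨hne, hγF⟩ := Finset.mem_erase.1 hγ
      obtain ⟨k, hk⟩ : ∃ k, β k < γ k := by
        by_contra! hcon
        refine hne (funext fun k => ?_)
        have hs : ∑ k, γ k = ∑ k, β k := by rw [hF γ hγF, hF β hβ]
        exact (Finset.sum_eq_sum_iff_of_le fun k _ => hcon k).1 hs k (Finset.mem_univ k)
      exact Submodule.smul_mem_smul (monomial_mem_powIdeal x (Set.mem_univ k) hk) (hf γ)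
    choose! a ha b hb hab using hfq
    have hmem : ∀ β ∈ F, ∏ k, x k ^ β k ∈ q ^ n := fun β hβ =>
      monomial_mem_pow (I := q) (x := x) (fun k => Ideal.subset_span ⟨k, rfl⟩) (hF β hβ).ge
    have hb' : ∑ β ∈ F, (∏ k, x k ^ β k) • b β ∈ q ^ n • N :=
      Submodule.sum_mem _ fun β hβ => Submodule.smul_mem_smul (hmem β hβ) (hb β hβ)
    have hsum : ∑ β ∈ F, (∏ k, x k ^ β k) • f β =
        ∑ β ∈ F, (∏ k, x k ^ β k) • b β + ∑ β ∈ F, (∏ k, x k ^ β k) • a β := by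
      rw [← Finset.sum_add_distrib]
      exact Finset.sum_congr rfl fun β hβ => by rw [← hab β hβ, smul_add, add_comm]
    refine Submodule.mem_sup.2 ⟨_, hb', _, ⟨?_, ?_⟩, hsum.symm⟩
    · refine Submodule.sum_mem _ fun β hβ => ?_
      rw [pow_succ, mul_smul]
      exact Submodule.smul_mem_smul (hmem β hβ) (ha β hβ)
    · rw [eq_sub_of_add_eq' hsum.symm]
      exact sub_mem hzN (Submodule.smul_le_right hb')
  have iter : ∀ k, q ^ n • D ⊓ N ≤ q ^ n • N ⊔ (q ^ (n + k) • D ⊓ N) := by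
    intro k
    induction k with
    | zero => exact le_sup_right
    | succ k ih =>
      refine ih.trans (sup_le le_sup_left ((step (n + k)).trans (sup_le_sup_right ?_ _)))
      exact Submodule.smul_mono_left (Ideal.pow_le_pow_right (Nat.le_add_right n k))
  obtain ⟨c, hc⟩ := exists_maximalIdeal_pow_smul_inf_le N
  intro z hz
  refine mem_of_forall_mem_sup_maximalIdeal_pow fun k => ?_
  have hle : q ^ n • N ⊔ (q ^ (n + (k + c)) • D ⊓ N) ≤
      q ^ n • N ⊔ maximalIdeal R ^ k • (⊤ : Submodule R M) := by
    refine sup_le_sup_left (le_trans (inf_le_inf_right N ?_)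
      ((hc k).trans (Submodule.smul_mono le_rfl le_top))) _
    exact Submodule.smul_mono ((Ideal.pow_right_mono hqm _).trans
      (Ideal.pow_le_pow_right (Nat.le_add_left _ _))) le_top
  exact hle (iter (k + c) hz)

theorem QuasiRegularMod.parametricOn_submodule (h : QuasiRegularMod x D N)
    (hx : ∀ i, x i ∈ maximalIdeal R) (hND : N ≤ D) (hD : ParametricOn x D) :
    ParametricOn x N := by
  classical
  -- With no variables and n ≥ 2 there is no admissible α, so decomposition for D puts every element
  -- of M in 0.
  rcases isEmpty_or_nonempty ι with hι | hι
  · intro n hn p hp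
    rcases hn.eq_or_lt with rfl | hn
    · have := hp (fun _ => 1) (fun _ => le_rfl) (by simp)
      rwa [powIdeal_univ_one, ← pow_one (Ideal.span _)] at this
    · have hz := hD n hn.le p (fun α _ hα => by simp at hα; omega)
      have hq : Ideal.span (Set.range x) = ⊥ := by simp [Set.range_eq_empty]
      rw [hq, ← Ideal.zero_eq_bot, zero_pow (by omega), Ideal.zero_eq_bot, Submodule.bot_smul,
        Submodule.mem_bot] at hz
      simp [hz]
  · intro n hn p hp
    have hpD := hD n hn p fun α h1 h2 => Submodule.smul_mono le_rfl hND (hp α h1 h2)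
    refine h.span_pow_smul_inf_le hx n ⟨hpD, ?_⟩
    obtain ⟨i⟩ := hι
    -- Membership in N follows from one admissible tuple: n at i and 1 elsewhere.
    refine Submodule.smul_le_right
      (hp (fun k => 1 + (Pi.single i (n - 1) : ι → ℕ) k) (fun _ => by omega) ?_)
    rw [Finset.sum_add_distrib]
    simp
    omega

end Local

end SeqCM

namespace SeqCM

/-! ### Consequences of regularity; ascent of decomposition. -/

section Regular

variable {R : Type*} [CommRing R] {M : Type*} [AddCommGroup M] [Module R M] {ι : Type*}
  {x : ι → R} {D N : Submodule R M}

theorem RegularMod.mem_of_pow_smul_mem (h : RegularMod x D N) {T : Set ι} {i : ι} (hi : i ∉ T)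
    {α : ι → ℕ} (hα : ∀ j, 1 ≤ α j) (b : ℕ) {p : M} (hp : p ∈ D)
    (hb : x i ^ b • p ∈ powIdeal x α T • D ⊔ N) : p ∈ powIdeal x α T • D ⊔ N := by
  induction b generalizing p with
  | zero => simpa using hb
  | succ b ih =>
    rw [pow_succ, mul_smul] at hb
    exact h T i hi α hα p hp (ih (D.smul_mem _ hp) hb)

/-- Generators are added one at a time: by regularity the coefficient of x_i^{α_i} lies in N modulo
the ideal of the earlier powers, so it can be replaced by an element of N. -/
theorem RegularMod.powIdeal_smul_inf_le (h : RegularMod x D N) {α : ι → ℕ}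
    (hα : ∀ j, 1 ≤ α j) (T : Finset ι) :
    powIdeal x α T • D ⊓ N ≤ powIdeal x α T • N := by
  classical
  induction T using Finset.induction_on with
  | empty => simp [powIdeal]
  | insert i T hi ih =>
    rintro z ⟨hz, hzN⟩
    rw [Finset.coe_insert] at hz ⊢
    obtain ⟨m, hm, v, hv, rfl⟩ := mem_powIdeal_insert_smul hz
    have hmem : m ∈ powIdeal x α T • D ⊔ N := by
      refine h.mem_of_pow_smul_mem (by simpa using hi) hα (α i) hm ?_
      rw [← add_sub_cancel_right (x i ^ α i • m) v]
      exact sub_mem (Submodule.mem_sup_right hzN) (Submodule.mem_sup_left hv)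
    obtain ⟨v', hv', n, hn, rfl⟩ := Submodule.mem_sup.1 hmem
    have hle := Submodule.smul_mono_left (N := N) (powIdeal_mono x α (Set.subset_insert i (T : Set ι)))
    have hn' : x i ^ α i • n ∈ powIdeal x α (insert i (T : Set ι)) • N :=
      Submodule.smul_mem_smul (pow_mem_powIdeal x α (Set.mem_insert _ _)) hn
    have hrest : x i ^ α i • v' + v ∈ powIdeal x α T • N := by
      refine ih ⟨add_mem (Submodule.smul_mem _ _ hv') hv, ?_⟩
      have : x i ^ α i • v' + v = x i ^ α i • (v' + n) + v - x i ^ α i • n := by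
        rw [smul_add]; abel
      rw [this]
      exact sub_mem hzN (N.smul_mem _ hn)
    have : x i ^ α i • (v' + n) + v = x i ^ α i • v' + v + x i ^ α i • n := by
      rw [smul_add]; abel
    rw [this]
    exact add_mem (hle hrest) hn'

variable [Fintype ι]

theorem RegularMod.quasiRegularMod (h : RegularMod x D N) : QuasiRegularMod x D N := by
  classical
  intro β
  -- `a T` raises exponents only on T; cancelling x_i^{β_i} lowers the exponent at i from β_i + 1 to
  -- 1, so the factors are peeled off one variable at a time.
  let a : Finset ι → ι → ℕ := fun T j => if j ∈ T then β j + 1 else 1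
  suffices H : ∀ T : Finset ι, ∀ p ∈ D,
      (∏ j ∈ T, x j ^ β j) • p ∈ powIdeal x (a T) Set.univ • D ⊔ N →
      p ∈ Ideal.span (Set.range x) • D ⊔ N by
    intro p hp hβ
    refine H Finset.univ p hp ?_
    simpa [a] using hβ
  intro T
  induction T using Finset.induction_on with
  | empty =>
    intro p _ hβ
    have ha : a ∅ = fun _ => 1 := by funext j; simp [a]
    rw [ha, powIdeal_univ_one] at hβ
    simpa using hβ
  | insert i T hi ih =>
    intro p hp hβ
    refine ih p hp ?_
    have huniv : (Set.univ : Set ι) = insert i {i}ᶜ := by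
      ext j; simp [em]
    rw [Finset.prod_insert hi, mul_smul] at hβ
    set p' := (∏ j ∈ T, x j ^ β j) • p with hp'
    have hp'D : p' ∈ D := D.smul_mem _ hp
    clear_value p'
    obtain ⟨z, hz, n, hn, hzn⟩ := Submodule.mem_sup.1 hβ
    rw [huniv] at hz
    obtain ⟨m, hm, v, hv, rfl⟩ := mem_powIdeal_insert_smul hz
    have hai : a (insert i T) i = β i + 1 := by simp [a]
    have hmem : p' - x i • m ∈ powIdeal x (a (insert i T)) {i}ᶜ • D ⊔ N := by
      refine h.mem_of_pow_smul_mem (i := i) (by simp) (fun j => ?_) (β i)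
        (D.sub_mem hp'D (D.smul_mem _ hm)) ?_
      · by_cases hj : j ∈ insert i T <;> simp only [a, hj, if_true, if_false] <;> omega
      · rw [smul_sub, smul_smul, ← pow_succ, ← hai, ← hzn]
        have : x i ^ a (insert i T) i • m + v + n - x i ^ a (insert i T) i • m = v + n := by abel
        rw [this]
        exact Submodule.add_mem_sup hv hn
    have hle : powIdeal x (a (insert i T)) {i}ᶜ ≤ powIdeal x (a T) Set.univ := by
      rw [powIdeal_congr x (β := a T) fun j hj => ?_]
      · exact powIdeal_mono x _ (Set.subset_univ _)
      · have : j ≠ i := hj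
        simp [a, this]
    have hle' : powIdeal x (a (insert i T)) {i}ᶜ • D ⊔ N ≤ powIdeal x (a T) Set.univ • D ⊔ N :=
      sup_le_sup_right (Submodule.smul_mono_left hle) N
    rw [← sub_add_cancel p' (x i • m)]
    refine add_mem (hle' hmem) (Submodule.mem_sup_left (Submodule.smul_mem_smul ?_ hm))
    have := pow_mem_powIdeal x (a T) (Set.mem_univ i)
    simpa [a, hi] using this

/-- Induction on n: once p ∈ 𝔮ⁿD + N, the tuple α = β + 1 isolates the coefficient of x^β, and
quasi-regularity moves it into 𝔮D + N. -/
theorem QuasiRegularMod.mem_span_pow_smul_sup [Nonempty ι] (h : QuasiRegularMod x D N) {n : ℕ}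
    (hn : 1 ≤ n) {p : M} (hp : p ∈ D)
    (hα : ∀ α : ι → ℕ, (∀ i, 1 ≤ α i) → ∑ i, α i + 1 = Fintype.card ι + n →
      p ∈ powIdeal x α Set.univ • D ⊔ N) : p ∈ Ideal.span (Set.range x) ^ n • D ⊔ N := by
  classical
  induction n, hn using Nat.le_induction with
  | base =>
    have := hα (fun _ => 1) (fun _ => le_rfl) (by simp)
    rwa [powIdeal_univ_one, ← pow_one (Ideal.span _)] at this
  | succ n hn ih =>
    obtain ⟨i⟩ := ‹Nonempty ι›
    have hpn := ih fun α h1 h2 => by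
      have hle : powIdeal x (fun k => α k + (Pi.single i 1 : ι → ℕ) k) Set.univ • D ⊔ N ≤
          powIdeal x α Set.univ • D ⊔ N :=
        sup_le_sup_right (Submodule.smul_mono_left
          (powIdeal_le_of_le x fun k _ => Nat.le_add_right _ _)) N
      refine hle (hα _ (fun k => (h1 k).trans (Nat.le_add_right _ _)) ?_)
      rw [Finset.sum_add_distrib]
      simp
      omega
    obtain ⟨s, hs, w, hw, rfl⟩ := Submodule.mem_sup.1 hpn
    obtain ⟨F, hF, f, hf, rfl⟩ := exists_sum_of_mem_span_pow_smul hs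
    refine add_mem (Submodule.sum_mem _ fun β hβ => ?_) (Submodule.mem_sup_right hw)
    have hfβ : f β ∈ Ideal.span (Set.range x) • D ⊔ N := by
      refine h β (f β) (hf β) ?_
      have hsum : (∏ k, x k ^ β k) • f β = (∑ γ ∈ F, (∏ k, x k ^ γ k) • f γ + w)
          - w - ∑ γ ∈ F.erase β, (∏ k, x k ^ γ k) • f γ := by
        rw [← Finset.add_sum_erase F _ hβ]
        abel
      rw [hsum]
      refine sub_mem (sub_mem (hα _ (fun k => by omega) ?_) (Submodule.mem_sup_right hw))
        (Submodule.sum_mem _ fun γ hγ => Submodule.mem_sup_left ?_)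
      · rw [Finset.sum_add_distrib, hF β hβ]
        simp
        omega
      · obtain ⟨hne, hγF⟩ := Finset.mem_erase.1 hγ
        obtain ⟨k, hk⟩ : ∃ k, β k < γ k := by
          by_contra! hcon
          refine hne (funext fun k => ?_)
          have hs : ∑ k, γ k = ∑ k, β k := by rw [hF γ hγF, hF β hβ]
          exact (Finset.sum_eq_sum_iff_of_le fun k _ => hcon k).1 hs k (Finset.mem_univ k)
        exact Submodule.smul_mem_smul (monomial_mem_powIdeal x (Set.mem_univ k) hk) (hf γ)
    have hmem : ∏ k, x k ^ β k ∈ Ideal.span (Set.range x) ^ n :=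
      monomial_mem_pow (I := Ideal.span (Set.range x)) (x := x)
        (fun k => Ideal.subset_span ⟨k, rfl⟩) (hF β hβ).ge
    obtain ⟨a, ha, b, hb, hab⟩ := Submodule.mem_sup.1 hfβ
    rw [← hab, smul_add]
    refine Submodule.add_mem_sup ?_ (N.smul_mem _ hb)
    rw [pow_succ, mul_smul]
    exact Submodule.smul_mem_smul hmem ha

/-- Parametric decomposition lifts along `N ≤ D` if `x` is regular on `D / N`. -/
theorem ParametricOn.of_submodule [Nonempty ι] (hN : ParametricOn x N) (h : RegularMod x D N)
    (hND : N ≤ D) : ParametricOn x D := by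
  intro n hn p hp
  have hpD : p ∈ D := by
    obtain ⟨i⟩ := ‹Nonempty ι›
    classical
    refine Submodule.smul_le_right
      (hp (fun k => 1 + (Pi.single i (n - 1) : ι → ℕ) k) (fun _ => by omega) ?_)
    rw [Finset.sum_add_distrib]
    simp
    omega
  obtain ⟨a, ha, b, hb, rfl⟩ := Submodule.mem_sup.1
    (h.quasiRegularMod.mem_span_pow_smul_sup hn hpD
      fun α h1 h2 => Submodule.mem_sup_left (hp α h1 h2))
  refine add_mem ha (Submodule.smul_mono le_rfl hND (hN n hn b fun α h1 h2 => ?_))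
  have hbD : b ∈ powIdeal x α Set.univ • D := by
    rw [← add_sub_cancel_left a b]
    exact sub_mem (hp α h1 h2) (span_pow_smul_le_powIdeal_smul x D h2 ha)
  have := h.powIdeal_smul_inf_le h1 Finset.univ
  rw [Finset.coe_univ] at this
  exact this ⟨hbD, hb⟩

end Regular

/-! ### Discarding parameters that kill the submodule. -/

section Subfamily

variable {R : Type*} [CommRing R] {M : Type*} [AddCommGroup M] [Module R M] {ι : Type*}
  {x : ι → R} {D : Submodule R M} {P : ι → Prop}

theorem powIdeal_subtype_smul (hP : ∀ j, ¬ P j → ∀ m ∈ D, x j • m = 0) {α : ι → ℕ}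
    (hα : ∀ j, 1 ≤ α j) {E : Submodule R M} (hE : E ≤ D) :
    powIdeal (fun j : Subtype P => x j) (fun j => α j) Set.univ • E =
      powIdeal x α Set.univ • E := by
  refine le_antisymm (Submodule.smul_mono_left (Ideal.span_mono ?_)) ?_
  · rintro _ ⟨j, -, rfl⟩
    exact ⟨j, trivial, rfl⟩
  · refine Submodule.smul_le.2 fun r hr m hm => ?_
    rw [powIdeal] at hr
    induction hr using Submodule.span_induction with
    | mem r hr =>
      obtain ⟨j, -, rfl⟩ := hr
      by_cases hj : P j
      · exact Submodule.smul_mem_smul (pow_mem_powIdeal (fun j : Subtype P => x j)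
          (fun j => α j) (Set.mem_univ ⟨j, hj⟩)) hm
      · obtain ⟨b, hb⟩ := Nat.exists_eq_add_of_le (hα j)
        simp only [hb, add_comm 1 b, pow_succ, mul_smul, hP j hj m (hE hm), smul_zero, zero_mem]
    | zero => simp
    | add y z _ _ hy hz => rw [add_smul]; exact add_mem hy hz
    | smul s y _ hy => rw [smul_assoc]; exact Submodule.smul_mem _ _ hy

theorem span_subtype_pow_smul (hP : ∀ j, ¬ P j → ∀ m ∈ D, x j • m = 0) (n : ℕ) :
    Ideal.span (Set.range fun j : Subtype P => x j) ^ n • D = Ideal.span (Set.range x) ^ n • D := by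
  induction n with
  | zero => simp
  | succ n ih =>
    rw [pow_succ', pow_succ', mul_smul, mul_smul, ih, ← powIdeal_univ_one, ← powIdeal_univ_one]
    exact powIdeal_subtype_smul hP (fun _ => le_rfl) Submodule.smul_le_right

/-- Elements killing `D` are irrelevant for the parametric decomposition. -/
theorem parametricOn_subtype_iff [Fintype ι] [Fintype (Subtype P)] [Nonempty (Subtype P)]
    (hP : ∀ j, ¬ P j → ∀ m ∈ D, x j • m = 0) :
    ParametricOn (fun j : Subtype P => x j) D ↔ ParametricOn x D := by
  classical
  have hsum : ∀ α : ι → ℕ, ∑ j : Subtype P, α j + ∑ j : {j // ¬ P j}, α j = ∑ j, α j := by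
    intro α
    convert! Fintype.sum_subtype_add_sum_subtype P α
  have hcard := hsum fun _ => 1
  simp only [Finset.sum_const, Finset.card_univ, smul_eq_mul, mul_one] at hcard
  constructor
  · intro h n hn p hp
    rw [← span_subtype_pow_smul hP]
    refine h n hn p fun α h1 h2 => ?_
    set α' : ι → ℕ := fun j => if hj : P j then α ⟨j, hj⟩ else 1 with hα'
    have e1 : (fun j : Subtype P => α' j) = α := by
      funext j
      simp [hα', j.2]
    have h1' : ∀ j, 1 ≤ α' j := by
      intro j
      by_cases hj : P j
      · simpa [hα', hj] using h1 ⟨j, hj⟩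
      · simp [hα', hj]
    rw [← e1, powIdeal_subtype_smul hP h1' le_rfl]
    refine hp α' h1' ?_
    have e2 : ∑ j : {j // ¬ P j}, α' j = Fintype.card {j // ¬ P j} := by
      have : ∀ j : {j // ¬ P j}, α' j = 1 := fun j => by simp [hα', j.2]
      simp [this]
    have e3 : ∑ j : Subtype P, α' j = ∑ j, α j := by rw [← e1]
    rw [← hsum, e2, e3]
    omega
  · intro h n hn p hp
    rw [span_subtype_pow_smul hP]
    refine h n hn p fun α h1 h2 => ?_
    rw [← powIdeal_subtype_smul hP h1 le_rfl]
    obtain ⟨k⟩ := ‹Nonempty (Subtype P)›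
    have hge : Fintype.card {j // ¬ P j} ≤ ∑ j : {j // ¬ P j}, α j := by
      have : ∑ _j : {j // ¬ P j}, 1 ≤ ∑ j : {j // ¬ P j}, α j :=
        Finset.sum_le_sum fun j _ => h1 j
      simpa using this
    -- The surplus of the discarded exponents over 1 is moved to the surviving index k, which keeps
    -- the tuple admissible for the smaller family.
    set b := ∑ j : {j // ¬ P j}, α j - Fintype.card {j // ¬ P j} with hb
    set γ : Subtype P → ℕ := fun j => α j + (Pi.single k b : Subtype P → ℕ) j with hγ
    have hγsum : ∑ j, γ j = ∑ j : Subtype P, α j + b := by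
      rw [hγ, Finset.sum_add_distrib]
      simp
    have hle : powIdeal (fun j : Subtype P => x j) γ Set.univ ≤
        powIdeal (fun j : Subtype P => x j) (fun j => α j) Set.univ :=
      powIdeal_le_of_le _ fun j _ => Nat.le_add_right _ _
    refine Submodule.smul_mono_left hle (hp γ (fun j => (h1 j).trans (Nat.le_add_right _ _)) ?_)
    have := hsum α
    omega

end Subfamily

end SeqCM

namespace SeqCM

open IsLocalRing RingTheory.Sequence

/-! ### Dimension through coheights of primes. -/

section Dimension

universe u v

variable {R : Type u} [CommRing R] {M : Type v} [AddCommGroup M] [Module R M]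

/-- The coheight of p is dim R/p, and supports are closed under specialization. With the next lemma,
dim M is the supremum of coheights over the support. -/
theorem coheight_le_supportDim {p : PrimeSpectrum R} (hp : p ∈ Module.support R M) :
    (Order.coheight p : WithBot ℕ∞) ≤ Module.supportDim R M := by
  rw [Order.coheight_eq_krullDim_Ici]
  exact Order.krullDim_le_of_strictMono
    (fun q : Set.Ici p => (⟨q.1, Module.mem_support_mono q.2 hp⟩ : Module.support R M))
    fun _ _ h => h

theorem supportDim_le_of_forall_coheight_le {c : WithBot ℕ∞}
    (h : ∀ p ∈ Module.support R M, (Order.coheight p : WithBot ℕ∞) ≤ c) :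
    Module.supportDim R M ≤ c := by
  refine iSup_le fun q => ?_
  refine le_trans ?_ (h q.head.1 q.head.2)
  exact WithBot.coe_le_coe.2
    (Order.length_le_coheight_head (p := q.map Subtype.val fun _ _ h => h))

theorem mem_support_submodule_iff {N : Submodule R M} {p : PrimeSpectrum R} :
    p ∈ Module.support R N ↔ ∃ m ∈ N, ∀ r : R, r • m = 0 → r ∈ p.asIdeal := by
  rw [Module.mem_support_iff_exists_annihilator]
  simp only [SetLike.le_def, Submodule.mem_annihilator_span_singleton, Subtype.exists,
    SetLike.mk_smul_mk, Submodule.mk_eq_zero, exists_prop]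

theorem supportDim_sup_le (N₁ N₂ : Submodule R M) :
    Module.supportDim R (N₁ ⊔ N₂ : Submodule R M) ≤
      max (Module.supportDim R N₁) (Module.supportDim R N₂) := by
  refine supportDim_le_of_forall_coheight_le fun p hp => ?_
  obtain ⟨m, hm, hmp⟩ := mem_support_submodule_iff.1 hp
  obtain ⟨a, ha, b, hb, rfl⟩ := Submodule.mem_sup.1 hm
  by_cases h1 : ∀ r : R, r • a = 0 → r ∈ p.asIdeal
  · exact le_max_of_le_left (coheight_le_supportDim (mem_support_submodule_iff.2 ⟨a, ha, h1⟩))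
  · push Not at h1
    obtain ⟨r, hr, hrp⟩ := h1
    refine le_max_of_le_right (coheight_le_supportDim
      (mem_support_submodule_iff.2 ⟨b, hb, fun s hs => ?_⟩))
    refine (p.isPrime.mem_or_mem (hmp (r * s) ?_)).resolve_left hrp
    rw [smul_add, mul_smul r s b, hs, smul_zero, mul_comm, mul_smul, hr, smul_zero, add_zero]

end Dimension

/-! ### Parameters, depth and finite length over a local ring. -/

section Local

universe u v

variable {R : Type u} [CommRing R] [IsLocalRing R]

theorem coheight_eq_zero_of_asIdeal_eq {p : PrimeSpectrum R} (h : p.asIdeal = maximalIdeal R) :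
    Order.coheight p = 0 := by
  rw [Order.coheight_eq_zero]
  intro q _
  change q.asIdeal ≤ p.asIdeal
  rw [h]
  exact le_maximalIdeal q.isPrime.ne_top

theorem asIdeal_eq_of_coheight_le_zero {p : PrimeSpectrum R} (h : Order.coheight p ≤ 0) :
    p.asIdeal = maximalIdeal R := by
  have hmax := Order.coheight_eq_zero.1 (le_antisymm h zero_le)
  have hle : p ≤ closedPoint R := le_maximalIdeal p.isPrime.ne_top
  exact le_antisymm hle (hmax hle)

variable [IsNoetherianRing R] {M : Type v} [AddCommGroup M] [Module R M] [Module.Finite R M]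

/-- The dimension is at most the number of parameters. -/
theorem supportDim_le_length (rs : List R) (hrs : ∀ r ∈ rs, r ∈ maximalIdeal R)
    (h : ∀ q ∈ Module.support R M, (∀ r ∈ rs, r ∈ q.asIdeal) → q.asIdeal = maximalIdeal R) :
    Module.supportDim R M ≤ (rs.length : WithBot ℕ∞) := by
  induction rs generalizing M with
  | nil =>
    refine supportDim_le_of_forall_coheight_le fun p hp => ?_
    rw [coheight_eq_zero_of_asIdeal_eq (h p hp (by simp))]
    simp
  | cons x rs ih =>
    have h1 := Module.supportDim_le_supportDim_quotSMulTop_succ (M := M)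
      (hrs x List.mem_cons_self)
    have h2 := ih (M := QuotSMulTop x M) (fun r hr => hrs r (List.mem_cons_of_mem _ hr))
      (fun q hq hqrs => by
        rw [Module.support_quotSMulTop] at hq
        refine h q hq.1 fun r hr => ?_
        rcases List.mem_cons.1 hr with rfl | hr
        · exact hq.2 (Set.mem_singleton _)
        · exact hqrs r hr)
    refine h1.trans ?_
    rw [List.length_cons, Nat.cast_succ]
    gcongr

theorem coheight_le_length (p : PrimeSpectrum R) (rs : List R)
    (hrs : ∀ r ∈ rs, r ∈ maximalIdeal R)
    (h : ∀ q : PrimeSpectrum R, p ≤ q → (∀ r ∈ rs, r ∈ q.asIdeal) →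
      q.asIdeal = maximalIdeal R) : Order.coheight p ≤ rs.length := by
  have hsupp : ∀ q : PrimeSpectrum R, q ∈ Module.support R (R ⧸ p.asIdeal) ↔ p ≤ q := by
    intro q
    rw [Module.mem_support_iff_of_finite, Ideal.annihilator_quotient]
    rfl
  have := (coheight_le_supportDim ((hsupp p).2 le_rfl)).trans
    (supportDim_le_length rs hrs fun q hq => h q ((hsupp q).1 hq))
  exact_mod_cast this

omit [IsLocalRing R] [Module.Finite R M] in
theorem exists_isAssociatedPrime_mem_of_not_isSMulRegular {x : R} (h : ¬ IsSMulRegular M x) :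
    ∃ p : PrimeSpectrum R, IsAssociatedPrime p.asIdeal M ∧ x ∈ p.asIdeal := by
  have : x ∈ ⋃ p ∈ associatedPrimes R M, (p : Set R) := by
    rw [biUnion_associatedPrimes_eq_compl_regular]
    exact h
  obtain ⟨p, hp, hx⟩ := Set.mem_iUnion₂.1 this
  exact ⟨⟨p, hp.isPrime⟩, hp, hx⟩

omit [IsLocalRing R] [IsNoetherianRing R] in
theorem mem_support_of_isAssociatedPrime {p : PrimeSpectrum R}
    (hp : IsAssociatedPrime p.asIdeal M) : p ∈ Module.support R M := by
  rw [Module.mem_support_iff_of_finite, ← Submodule.annihilator_top]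
  exact hp.annihilator_le

/-- A weakly regular sequence in the maximal ideal is no longer than the dimension of any
associated prime. -/
theorem length_le_coheight_of_isAssociatedPrime (rs : List R)
    (hrs : ∀ r ∈ rs, r ∈ maximalIdeal R) (hreg : IsWeaklyRegular M rs) {p : PrimeSpectrum R}
    (hp : IsAssociatedPrime p.asIdeal M) : (rs.length : ℕ∞) ≤ Order.coheight p := by
  induction rs generalizing M p with
  | nil => simp
  | cons a rs ih =>
    obtain ⟨ha, hrest⟩ := (isWeaklyRegular_cons_iff M a rs).1 hreg
    obtain ⟨_, y, hy⟩ := isAssociatedPrime_iff.1 hp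
    have hap : a ∉ p.asIdeal := by
      intro hmem
      rw [hy, Submodule.mem_colon_singleton, Submodule.mem_bot] at hmem
      have hy0 : y = 0 := ha.right_eq_zero_of_smul hmem
      apply p.isPrime.ne_top
      rw [hy, hy0]
      simp
    let L : Submodule R M :=
      { carrier := {m | ∀ r ∈ p.asIdeal, r • m = 0}
        zero_mem' := fun r _ => smul_zero r
        add_mem' := fun hm hn r hr => by rw [smul_add, hm r hr, hn r hr, add_zero]
        smul_mem' := fun c m hm r hr => by rw [smul_comm, hm r hr, smul_zero] }
    -- If L = (0 :_M p) were inside aM, then L = aL because a is a nonzerodivisor, and Nakayama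
    -- would give L = 0 although y ∈ L. The class of z in M/aM then yields an associated prime
    -- containing both p and a.
    obtain ⟨z, hzL, hz⟩ : ∃ z ∈ L, z ∉ Ideal.span {a} • (⊤ : Submodule R M) := by
      by_contra! hcon
      have hL : L ≤ maximalIdeal R • L := by
        intro z hz
        have := hcon z hz
        rw [Submodule.ideal_span_singleton_smul] at this
        obtain ⟨w, -, rfl⟩ := (Submodule.mem_smul_pointwise_iff_exists _ _ _).1 this
        refine Submodule.smul_mem_smul (hrs a List.mem_cons_self) fun r hr => ?_
        refine ha.right_eq_zero_of_smul ?_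
        rw [smul_comm]
        exact hz r hr
      have hbot := Submodule.eq_bot_of_le_smul_of_le_jacobson_bot _ L (IsNoetherian.noetherian L) hL
        (maximalIdeal_le_jacobson _)
      have hyL : y ∈ L := by
        intro r hr
        rw [hy, Submodule.mem_colon_singleton, Submodule.mem_bot] at hr
        exact hr
      rw [hbot, Submodule.mem_bot] at hyL
      apply p.isPrime.ne_top
      rw [hy, hyL]
      simp
    rw [Submodule.ideal_span_singleton_smul] at hz
    obtain ⟨q, hq, hqle⟩ := exists_le_isAssociatedPrime_of_isNoetherianRing R
      (Submodule.Quotient.mk z : QuotSMulTop a M) (by simpa using hz)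
    have hlt : p < ⟨q, hq.isPrime⟩ := by
      refine lt_of_le_of_ne (fun r hr => hqle ?_) fun h => hap ?_
      · rw [Submodule.mem_colon_singleton, ← Submodule.Quotient.mk_smul, hzL r hr]
        simp
      · rw [h]
        refine hqle ?_
        rw [Submodule.mem_colon_singleton, ← Submodule.Quotient.mk_smul, Submodule.mem_bot,
          Submodule.Quotient.mk_eq_zero]
        exact Submodule.smul_mem_pointwise_smul _ _ _ trivial
    have := ih (fun r hr => hrs r (List.mem_cons_of_mem _ hr)) hrest
      (p := ⟨q, hq.isPrime⟩) hq
    rw [List.length_cons, Nat.cast_succ]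
    exact (add_le_add_left this 1).trans (Order.coheight_add_one_le hlt)

open CategoryTheory Abelian in
/-- Dividing by a nonzerodivisor of the maximal ideal lowers the depth by at most one. -/
theorem exists_isRegular_quotSMulTop [Small.{v} R] [Nontrivial M] {x : R}
    (hx : x ∈ maximalIdeal R) (hreg : IsSMulRegular M x) {n : ℕ}
    (h : ∃ rs : List R, rs.length = n + 1 ∧ (∀ r ∈ rs, r ∈ maximalIdeal R) ∧ IsRegular M rs) :
    ∃ rs : List R, rs.length = n ∧ (∀ r ∈ rs, r ∈ maximalIdeal R) ∧
      IsRegular (QuotSMulTop x M) rs := by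
  have hlt : ∀ (P : Type v) [AddCommGroup P] [Module R P] [Module.Finite R P] [Nontrivial P],
      maximalIdeal R • (⊤ : Submodule R P) < ⊤ := fun P _ _ _ _ =>
    (Submodule.top_ne_ideal_smul_of_le_jacobson_annihilator
      (maximalIdeal_le_jacobson _)).symm.lt_top
  have hnt := nontrivial_quotSMulTop_of_mem_maximalIdeal M hx
  -- This is the residue field k in the universe of M. Extⁱ(k, M) = 0 for i ≤ n, so the long exact
  -- sequence gives Extⁱ(k, M/xM) = 0 for i < n.
  let N : ModuleCat.{v} R := ModuleCat.of R (Shrink.{v} (R ⧸ maximalIdeal R))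
  have hNfin : Module.Finite R N := Module.Finite.equiv (Shrink.linearEquiv R _).symm
  have hN : Module.support R N = PrimeSpectrum.zeroLocus (maximalIdeal R) := by
    rw [(Shrink.linearEquiv R (R ⧸ maximalIdeal R)).support_eq, Module.support_eq_zeroLocus,
      Ideal.annihilator_quotient]
  obtain ⟨rs, hlen, hmem, hrs⟩ := h
  have hext := ModuleCat.subsingleton_ext_of_exists_isRegular (maximalIdeal R) N hN.subset
    (ModuleCat.of R M) (hlt M) rs hmem hrs
  refine ModuleCat.exists_isRegular_of_exists_subsingleton_ext (maximalIdeal R) n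
    (ModuleCat.of R (QuotSMulTop x M)) (hlt _) N hN fun i hi => ?_
  have zero1 := AddCommGrpCat.isZero_of_iff_subsingleton.mpr (hext i (by omega))
  have zero2 := AddCommGrpCat.isZero_of_iff_subsingleton.mpr (hext (i + 1) (by omega))
  have hreg' : IsSMulRegular (ModuleCat.of R M) x := hreg
  exact AddCommGrpCat.subsingleton_of_isZero <| ShortComplex.Exact.isZero_of_both_zeros
    ((Ext.covariant_sequence_exact₃' N hreg'.smulShortComplex_shortExact) i (i + 1) rfl)
    (zero1.eq_zero_of_src _) (zero2.eq_zero_of_tgt _)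

theorem isWeaklyRegular_of_parameters_of_small [Small.{v} R] [Nontrivial M] (rs : List R)
    (hrs : ∀ r ∈ rs, r ∈ maximalIdeal R)
    (h : ∀ q ∈ Module.support R M, (∀ r ∈ rs, r ∈ q.asIdeal) → q.asIdeal = maximalIdeal R)
    (hdepth : ∃ ss : List R, ss.length = rs.length ∧ (∀ r ∈ ss, r ∈ maximalIdeal R) ∧
      IsRegular M ss) : IsWeaklyRegular M rs := by
  induction rs generalizing M with
  | nil => exact IsWeaklyRegular.nil R M
  | cons x rs ih =>
    have hx := hrs x List.mem_cons_self
    have hrs' : ∀ r ∈ rs, r ∈ maximalIdeal R := fun r hr => hrs r (List.mem_cons_of_mem _ hr)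
    have hreg : IsSMulRegular M x := by
      -- An associated prime containing x would have coheight at least `rs.length + 1` by depth, yet
      -- at most `rs.length`, as `rs` alone are parameters modulo it.
      by_contra hcon
      obtain ⟨p, hp, hxp⟩ := exists_isAssociatedPrime_mem_of_not_isSMulRegular hcon
      obtain ⟨ss, hlen, hmem, hss⟩ := hdepth
      have h1 := length_le_coheight_of_isAssociatedPrime ss hmem hss.toIsWeaklyRegular hp
      have h2 := coheight_le_length p rs hrs' fun q hpq hq =>
        h q (Module.mem_support_mono hpq (mem_support_of_isAssociatedPrime hp)) fun r hr => by
          rcases List.mem_cons.1 hr with rfl | hr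
          · exact hpq hxp
          · exact hq r hr
      have h3 := h1.trans h2
      rw [hlen, List.length_cons] at h3
      have : rs.length + 1 ≤ rs.length := by exact_mod_cast h3
      omega
    refine (isWeaklyRegular_cons_iff M x rs).2 ⟨hreg, ?_⟩
    have hnt := nontrivial_quotSMulTop_of_mem_maximalIdeal M hx
    refine ih hrs' (fun q hq hqrs => ?_) (exists_isRegular_quotSMulTop hx hreg hdepth)
    rw [Module.support_quotSMulTop] at hq
    refine h q hq.1 fun r hr => ?_
    rcases List.mem_cons.1 hr with rfl | hr
    · exact hq.2 (Set.mem_singleton _)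
    · exact hqrs r hr

/-- If the depth is at least the number of parameters, then the parameters are regular. -/
theorem isWeaklyRegular_of_parameters [Nontrivial M] (rs : List R)
    (hrs : ∀ r ∈ rs, r ∈ maximalIdeal R)
    (h : ∀ q ∈ Module.support R M, (∀ r ∈ rs, r ∈ q.asIdeal) → q.asIdeal = maximalIdeal R)
    (hdepth : ∃ ss : List R, ss.length = rs.length ∧ (∀ r ∈ ss, r ∈ maximalIdeal R) ∧
      IsRegular M ss) : IsWeaklyRegular M rs := by
  -- Lifting makes R small relative to the universe of the module, as the Ext argument requires.
  let e : ULift.{u} M ≃ₗ[R] M := ULift.moduleEquiv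
  have hfin : Module.Finite R (ULift.{u} M) := Module.Finite.equiv e.symm
  have hnt : Nontrivial (ULift.{u} M) := e.toEquiv.nontrivial
  refine (e.isWeaklyRegular_congr rs).1
    (isWeaklyRegular_of_parameters_of_small rs hrs (fun q hq => h q (e.support_eq ▸ hq)) ?_)
  obtain ⟨ss, h1, h2, h3⟩ := hdepth
  exact ⟨ss, h1, h2, (e.isRegular_congr ss).2 h3⟩

theorem maximalIdeal_pow_le_of_forall {I : Ideal R}
    (h : ∀ q : PrimeSpectrum R, I ≤ q.asIdeal → q.asIdeal = maximalIdeal R) :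
    ∃ k : ℕ, maximalIdeal R ^ k ≤ I := by
  refine Ideal.exists_pow_le_of_le_radical_of_fg ?_ (IsNoetherian.noetherian _)
  rw [Ideal.radical_eq_sInf]
  refine le_sInf fun J hJ => ?_
  have := h ⟨J, hJ.2⟩ hJ.1
  exact this.ge

/-- The chain 𝔪^k M stabilizes, and Krull's theorem makes its stable value 0; so 𝔪^k lies in the
annihilator. -/
theorem asIdeal_eq_of_isFiniteLength (h : IsFiniteLength R M) {q : PrimeSpectrum R}
    (hq : q ∈ Module.support R M) : q.asIdeal = maximalIdeal R := by
  obtain ⟨_, hart⟩ := isFiniteLength_iff_isNoetherian_isArtinian.1 h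
  obtain ⟨k, hk⟩ := IsArtinian.monotone_stabilizes (R := R) (M := M)
    ⟨fun k => OrderDual.toDual (maximalIdeal R ^ k • (⊤ : Submodule R M)),
      fun a b hab => Submodule.smul_mono_left (Ideal.pow_le_pow_right hab)⟩
  have hbot : maximalIdeal R ^ k • (⊤ : Submodule R M) = ⊥ := by
    rw [← Ideal.iInf_pow_smul_eq_bot_of_isLocalRing (M := M) (maximalIdeal R)
      (Ideal.IsPrime.ne_top inferInstance)]
    refine le_antisymm (le_iInf fun i => ?_) (iInf_le _ k)
    rcases le_total k i with hki | hki
    · exact (OrderDual.toDual_inj.1 (hk i hki)).le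
    · exact Submodule.smul_mono_left (Ideal.pow_le_pow_right hki)
  refine le_antisymm (le_maximalIdeal q.isPrime.ne_top) ?_
  refine q.isPrime.le_of_pow_le (n := k) (le_trans ?_ (Module.annihilator_le_of_mem_support hq))
  intro r hr
  rw [Module.mem_annihilator]
  intro m
  have : r • m ∈ maximalIdeal R ^ k • (⊤ : Submodule R M) := Submodule.smul_mem_smul hr trivial
  rwa [hbot] at this

theorem isFiniteLength_of_forall_asIdeal_eq
    (h : ∀ q ∈ Module.support R M, q.asIdeal = maximalIdeal R) : IsFiniteLength R M := by
  suffices H : ∀ (M : Type v) [AddCommGroup M] [Module R M] [Module.Finite R M],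
      (∀ q ∈ Module.support R M, q.asIdeal = maximalIdeal R) → IsArtinian R M from
    isFiniteLength_iff_isNoetherian_isArtinian.2 ⟨inferInstance, H M h⟩
  intro M _ _ hfin
  induction hfin using IsNoetherianRing.induction_on_isQuotientEquivQuotientPrime R with
  | subsingleton N => intro _; infer_instance
  | quotient N p f =>
    intro h
    have hp : p.asIdeal = maximalIdeal R := h p (by
      rw [f.support_eq, Module.mem_support_iff_of_finite, Ideal.annihilator_quotient])
    have hmax : p.asIdeal.IsMaximal := by rw [hp]; infer_instance
    have : IsSimpleModule R (R ⧸ p.asIdeal) := by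
      rw [isSimpleModule_iff_isCoatom]
      exact Ideal.isMaximal_def.1 hmax
    exact f.symm.isArtinian_iff.1 inferInstance
  | exact N₁ N₂ N₃ f g hf hg hfg h₁ h₃ =>
    intro h
    have := h₁ fun q hq => h q (Module.support_subset_of_injective f hf hq)
    have := h₃ fun q hq => h q (Module.support_subset_of_surjective g hg hq)
    exact isArtinian_of_range_eq_ker f g hfg.linearMap_ker_eq.symm

end Local

end SeqCM

namespace SeqCM

open IsLocalRing RingTheory.Sequence

/-! ### Existence, uniqueness and unmixedness of the dimension filtration. -/

section Filtration

universe u v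

variable {R : Type u} [CommRing R] [IsLocalRing R] [IsNoetherianRing R]
  {M : Type v} [AddCommGroup M] [Module R M]

omit [IsNoetherianRing R] in
theorem supportDim_localH0_le : Module.supportDim R (localH0 R M) ≤ 0 := by
  refine supportDim_le_of_forall_coheight_le fun p hp => ?_
  obtain ⟨m, ⟨k, hk⟩, hmp⟩ := mem_support_submodule_iff.1 hp
  have : maximalIdeal R ≤ p.asIdeal :=
    p.isPrime.le_of_pow_le (n := k) fun r hr => hmp r (hk r hr)
  rw [coheight_eq_zero_of_asIdeal_eq (le_antisymm (le_maximalIdeal p.isPrime.ne_top) this)]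
  simp

variable [Module.Finite R M]

theorem le_localH0_of_supportDim_le {N : Submodule R M} (h : Module.supportDim R N ≤ 0) :
    N ≤ localH0 R M := by
  obtain ⟨k, hk⟩ := maximalIdeal_pow_le_of_forall (I := Module.annihilator R N) fun q hq => by
    refine asIdeal_eq_of_coheight_le_zero ?_
    have := (coheight_le_supportDim (Module.mem_support_iff_of_finite.2 hq)).trans h
    exact_mod_cast this
  intro y hy
  refine ⟨k, fun r hr => ?_⟩
  have := Module.mem_annihilator.1 (hk hr) ⟨y, hy⟩
  exact congrArg Subtype.val this

omit [IsLocalRing R] in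
theorem exists_isGreatest_supportDim_lt {D : Submodule R M} (hD : ⊥ < Module.supportDim R D) :
    ∃ N, IsGreatest {N : Submodule R M | N ≤ D ∧
      Module.supportDim R N < Module.supportDim R D} N := by
  obtain ⟨N, hN, hmax⟩ := (wellFounded_gt (α := Submodule R M)).has_min
    {N : Submodule R M | N ≤ D ∧ Module.supportDim R N < Module.supportDim R D}
    ⟨⊥, bot_le, by rwa [Module.supportDim_eq_bot_of_subsingleton]⟩
  refine ⟨N, hN, fun L hL => ?_⟩
  by_contra hcon
  refine hmax (N ⊔ L) ⟨sup_le hN.1 hL.1, (supportDim_sup_le N L).trans_lt (max_lt hN.2 hL.2)⟩ ?_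
  exact left_lt_sup.2 hcon

/-- Built downwards: D is preceded by its largest submodule of smaller dimension, and the bound k
drops. The process stops at dimension at most 0, where D is H⁰_𝔪(M). -/
theorem exists_filtration (k : ℕ) (D : Submodule R M) (h0 : localH0 R M ≤ D)
    (hk : Module.supportDim R D ≤ k) :
    ∃ (t : ℕ) (F : Fin (t + 1) → Submodule R M), F 0 = localH0 R M ∧ F (Fin.last t) = D ∧
      ∀ i : Fin t, IsGreatest {N : Submodule R M | N ≤ F i.succ ∧
        Module.supportDim R N < Module.supportDim R (F i.succ)} (F i.castSucc) := by
  induction k generalizing D with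
  | zero =>
    exact ⟨0, fun _ => D, le_antisymm (le_localH0_of_supportDim_le (by simpa using hk)) h0, rfl,
      fun i => i.elim0⟩
  | succ k ih =>
    by_cases hle : Module.supportDim R D ≤ k
    · exact ih D h0 hle
    have hpos : (0 : WithBot ℕ∞) < Module.supportDim R D :=
      lt_of_le_of_lt (by exact_mod_cast Nat.zero_le k) (not_le.1 hle)
    obtain ⟨N, hN⟩ := exists_isGreatest_supportDim_lt (lt_of_le_of_lt bot_le hpos)
    obtain ⟨t, F, hF0, hFt, hF⟩ := ih N (hN.2 ⟨h0, supportDim_localH0_le.trans_lt hpos⟩) (by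
      have := hN.1.2.trans_le hk
      rw [Nat.cast_succ] at this
      exact ENat.WithBot.lt_add_one_iff.1 this)
    refine ⟨t + 1, Fin.snoc (α := fun _ => Submodule R M) F D, ?_, by simp, fun i => ?_⟩
    · rw [← Fin.castSucc_zero, Fin.snoc_castSucc, hF0]
    · induction i using Fin.lastCases with
      | last =>
        rw [Fin.succ_last, Fin.snoc_last, Fin.snoc_castSucc, hFt]
        exact hN
      | cast i =>
        rw [Fin.succ_castSucc, Fin.snoc_castSucc, Fin.snoc_castSucc]
        exact hF i

theorem exists_isDimensionFiltration {d : ℕ} (hM : Module.supportDim R M = d) :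
    ∃ (t : ℕ) (D : Fin (t + 1) → Submodule R M), IsDimensionFiltration R D := by
  obtain ⟨t, D, h0, ht, h⟩ := exists_filtration d (⊤ : Submodule R M) le_top
    (by rw [Module.supportDim_eq_of_equiv Submodule.topEquiv, hM])
  exact ⟨t, D, h0, ht, h⟩

omit [IsNoetherianRing R] [Module.Finite R M] in
theorem IsDimensionFiltration.lt_succ {t : ℕ} {D : Fin (t + 1) → Submodule R M}
    (hD : IsDimensionFiltration R D) (i : Fin t) : D i.castSucc < D i.succ :=
  lt_of_le_of_ne (hD.step i).1.1 fun h => (hD.step i).1.2.ne (by rw [h])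

omit [IsNoetherianRing R] [Module.Finite R M] in
theorem IsDimensionFiltration.strictMono {t : ℕ} {D : Fin (t + 1) → Submodule R M}
    (hD : IsDimensionFiltration R D) : StrictMono D :=
  Fin.strictMono_iff_lt_succ.2 hD.lt_succ

omit [IsNoetherianRing R] [Module.Finite R M] in
theorem IsDimensionFiltration.exists_eq_pair {t t' : ℕ} {D : Fin (t + 1) → Submodule R M}
    {D' : Fin (t' + 1) → Submodule R M} (hD : IsDimensionFiltration R D)
    (hD' : IsDimensionFiltration R D') {i : Fin t'} {s : Fin (t + 1)} (h : D' i.succ = D s) :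
    ∃ j : Fin t, D' i.succ = D j.succ ∧ D' i.castSucc = D j.castSucc := by
  induction s using Fin.cases with
  | zero =>
    have := hD'.strictMono (Fin.succ_pos i)
    rw [h, hD.bottom, hD'.bottom] at this
    exact absurd this (lt_irrefl _)
  | succ j =>
    refine ⟨j, h, ?_⟩
    have := hD'.step i
    rw [h] at this
    exact this.unique (hD.step j)

omit [IsNoetherianRing R] [Module.Finite R M] in
/-- The dimension filtration is unique, in terms of its pairs of consecutive members. -/
theorem IsDimensionFiltration.exists_eq {t t' : ℕ} {D : Fin (t + 1) → Submodule R M}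
    {D' : Fin (t' + 1) → Submodule R M} (hD : IsDimensionFiltration R D)
    (hD' : IsDimensionFiltration R D') (i : Fin t') :
    ∃ j : Fin t, D' i.succ = D j.succ ∧ D' i.castSucc = D j.castSucc := by
  have key : ∀ i : Fin (t' + 1), ∃ s, D' i = D s := by
    intro i
    induction i using Fin.reverseInduction with
    | last => exact ⟨Fin.last t, by rw [hD.top, hD'.top]⟩
    | cast i ih =>
      obtain ⟨s, hs⟩ := ih
      obtain ⟨j, -, hj⟩ := hD.exists_eq_pair hD' hs
      exact ⟨_, hj⟩
  obtain ⟨s, hs⟩ := key i.succ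
  exact hD.exists_eq_pair hD' hs

-- Unmixedness of D/N: if p is the annihilator of y modulo N and dim R/p < dim D, then N + Ry still
-- has dimension below dim D, so y ∈ N by maximality.
omit [IsLocalRing R] [Module.Finite R M] in
theorem supportDim_le_coheight_of_isGreatest {D N : Submodule R M}
    (hN : IsGreatest {L : Submodule R M | L ≤ D ∧
      Module.supportDim R L < Module.supportDim R D} N) {p : PrimeSpectrum R}
    (hp : IsAssociatedPrime p.asIdeal (D ⧸ N.submoduleOf D)) :
    Module.supportDim R D ≤ Order.coheight p := by
  obtain ⟨_, y, hy⟩ := isAssociatedPrime_iff.1 hp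
  obtain ⟨y, rfl⟩ := Submodule.Quotient.mk_surjective _ y
  have hmem : ∀ r : R, r ∈ p.asIdeal ↔ r • (y : M) ∈ N := by
    intro r
    rw [hy, Submodule.mem_colon_singleton, ← Submodule.Quotient.mk_smul, Submodule.mem_bot,
      Submodule.Quotient.mk_eq_zero]
    rfl
  by_contra! hlt
  have hL : Module.supportDim R (N ⊔ R ∙ (y : M) : Submodule R M) < Module.supportDim R D := by
    refine lt_of_le_of_lt ?_ (max_lt hN.1.2 hlt)
    refine supportDim_le_of_forall_coheight_le fun q hq => ?_
    obtain ⟨m, hm, hmq⟩ := mem_support_submodule_iff.1 hq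
    by_cases hpq : p ≤ q
    · exact le_max_of_le_right (WithBot.coe_le_coe.2 (Order.coheight_anti hpq))
    obtain ⟨r, hrp, hrq⟩ := SetLike.not_le_iff_exists.1 (show ¬ p.asIdeal ≤ q.asIdeal from hpq)
    obtain ⟨n, hn, z, hz, rfl⟩ := Submodule.mem_sup.1 hm
    obtain ⟨c, rfl⟩ := Submodule.mem_span_singleton.1 hz
    refine le_max_of_le_left (coheight_le_supportDim (mem_support_submodule_iff.2
      ⟨r • (n + c • (y : M)), ?_, fun s hs => ?_⟩))
    · rw [smul_add, smul_comm r c]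
      exact add_mem (N.smul_mem _ hn) (N.smul_mem _ ((hmem r).1 hrp))
    · rw [smul_smul] at hs
      exact (q.isPrime.mem_or_mem (hmq _ hs)).resolve_right hrq
  have hyN : (y : M) ∈ N := hN.2
    ⟨sup_le hN.1.1 ((Submodule.span_singleton_le_iff_mem _ _).2 y.2), hL⟩
    (Submodule.mem_sup_right (Submodule.mem_span_singleton_self _))
  exact p.isPrime.ne_top ((Ideal.eq_top_iff_one _).2 ((hmem 1).2 (by simpa using hyN)))

end Filtration

/-! ### Existence of good systems of parameters. -/

section Parameters

universe u v

variable {R : Type u} [CommRing R] [IsLocalRing R] [IsNoetherianRing R]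
  {M : Type v} [AddCommGroup M] [Module R M] [Module.Finite R M]

omit [IsLocalRing R] in
/-- Prime avoidance for one parameter. -/
theorem exists_mem_supportDim_quotSMulTop_le {k : ℕ} (hM : Module.supportDim R M ≤ (k + 1 : ℕ))
    {a : Ideal R} (ha : ∀ q : PrimeSpectrum R, a ≤ q.asIdeal → Order.coheight q ≤ k) :
    ∃ x ∈ a, Module.supportDim R (QuotSMulTop x M) ≤ k := by
  rcases subsingleton_or_nontrivial R with hR | hR
  · refine ⟨0, zero_mem _, ?_⟩
    have : Subsingleton (QuotSMulTop (0 : R) M) := Module.subsingleton R _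
    rw [Module.supportDim_eq_bot_of_subsingleton]
    exact bot_le
  -- Only the minimal primes of dimension above k must be avoided; none contains a, since primes
  -- over a have coheight at most k.
  set Z : Set (PrimeSpectrum R) :=
    {p | p.asIdeal ∈ (Module.annihilator R M).minimalPrimes ∧ ¬ Order.coheight p ≤ k}
  have hZ : Z.Finite := by
    refine Set.Finite.subset ((Ideal.finite_minimalPrimes_of_isNoetherianRing R
      (Module.annihilator R M)).preimage (f := PrimeSpectrum.asIdeal) fun p _ q _ h =>
        PrimeSpectrum.ext h) fun p hp => hp.1
  obtain ⟨p₀⟩ : Nonempty (PrimeSpectrum R) := inferInstance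
  have hnot : ¬ ((a : Set R) ⊆ ⋃ p ∈ Z, (p.asIdeal : Set R)) := by
    rw [Ideal.subset_union_prime_finite hZ p₀ p₀ fun p _ _ _ => p.isPrime]
    rintro ⟨p, hp, hle⟩
    exact hp.2 (ha p hle)
  obtain ⟨x, hxa, hx⟩ := Set.not_subset.1 hnot
  refine ⟨x, hxa, supportDim_le_of_forall_coheight_le fun q hq => ?_⟩
  rw [Module.support_quotSMulTop] at hq
  obtain ⟨P, hP, hPq⟩ := Ideal.exists_minimalPrimes_le (Module.annihilator_le_of_mem_support hq.1)
  let p : PrimeSpectrum R := ⟨P, hP.1.1⟩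
  have hpq : p ≤ q := hPq
  suffices Order.coheight q ≤ k by exact_mod_cast this
  by_cases hp : Order.coheight p ≤ k
  · exact (Order.coheight_anti hpq).trans hp
  have hxp : x ∉ p.asIdeal := fun h => hx (Set.mem_iUnion₂_of_mem (i := p) ⟨hP, hp⟩ h)
  have hlt : p < q := lt_of_le_of_ne hpq fun h => hxp (h ▸ hq.2 (Set.mem_singleton _))
  have h1 := Order.coheight_add_one_le hlt
  have h2 := (coheight_le_supportDim (p := p) (Module.mem_support_iff_of_finite.2 hP.1.2)).trans hM
  have h3 : Order.coheight p ≤ (k + 1 : ℕ) := by exact_mod_cast h2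
  have h4 := h1.trans h3
  rw [Nat.cast_succ] at h4
  exact (ENat.add_le_add_iff_right ENat.one_ne_top).1 h4

/-- Parameters are chosen from the last index down: the one at index k cuts the dimension bound from
k + 1 to k, which the bound on primes over `a k` permits. -/
theorem exists_parameters_mem (k : ℕ) (a : Fin k → Ideal R)
    (ha : ∀ j, ∀ q : PrimeSpectrum R, a j ≤ q.asIdeal → Order.coheight q ≤ (j : ℕ))
    (hM : Module.supportDim R M ≤ k) :
    ∃ x : Fin k → R, (∀ j, x j ∈ a j) ∧ (∀ j, x j ∈ maximalIdeal R) ∧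
      ∀ q ∈ Module.support R M, (∀ j, x j ∈ q.asIdeal) → q.asIdeal = maximalIdeal R := by
  induction k generalizing M with
  | zero =>
    refine ⟨Fin.elim0, fun j => j.elim0, fun j => j.elim0, fun q hq _ =>
      asIdeal_eq_of_coheight_le_zero ?_⟩
    have := (coheight_le_supportDim hq).trans hM
    exact_mod_cast this
  | succ k ih =>
    obtain ⟨y, hy, hdim⟩ := exists_mem_supportDim_quotSMulTop_le hM
      (a := a (Fin.last k) ⊓ maximalIdeal R) fun q hq => by
        rcases q.isPrime.inf_le.1 hq with h | h
        · simpa using ha (Fin.last k) q h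
        · rw [coheight_eq_zero_of_asIdeal_eq (le_antisymm (le_maximalIdeal q.isPrime.ne_top) h)]
          exact zero_le
    obtain ⟨x, hxa, hxm, hx⟩ := ih (fun j => a j.castSucc)
      (fun j q hq => by simpa using ha j.castSucc q hq) hdim
    refine ⟨Fin.snoc (α := fun _ => R) x y, fun j => ?_, fun j => ?_, fun q hq h => ?_⟩
    · induction j using Fin.lastCases with
      | last => simpa using hy.1
      | cast j => simpa using hxa j
    · induction j using Fin.lastCases with
      | last => simpa using hy.2
      | cast j => simpa using hxm j
    · refine hx q ?_ fun j => by simpa using h j.castSucc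
      rw [Module.support_quotSMulTop]
      refine ⟨hq, ?_⟩
      have := h (Fin.last k)
      rw [PrimeSpectrum.mem_zeroLocus, Set.singleton_subset_iff]
      simpa using this

-- By Artin–Rees, 𝔞^{c+1}M ∩ D = 𝔞(𝔞^c M ∩ D) ⊆ 𝔞D = 0 for 𝔞 = Ann D.
omit [IsLocalRing R] in
theorem exists_annihilator_pow_smul_inf_eq_bot (D : Submodule R M) :
    ∃ n : ℕ, Module.annihilator R D ^ n • (⊤ : Submodule R M) ⊓ D = ⊥ := by
  obtain ⟨c, hc⟩ := Ideal.exists_pow_inf_eq_pow_smul (Module.annihilator R D) D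
  refine ⟨c + 1, ?_⟩
  rw [hc (c + 1) (Nat.le_succ c), Nat.add_sub_cancel_left, pow_one, eq_bot_iff]
  refine (Submodule.smul_mono le_rfl inf_le_right).trans (Submodule.smul_le.2 fun r hr m hm => ?_)
  exact congrArg Subtype.val (Module.mem_annihilator.1 hr ⟨m, hm⟩)

theorem isSystemOfParameters_iff {d : ℕ} {x : Fin d → R} :
    IsSystemOfParameters M x ↔ Module.supportDim R M = d ∧ (∀ i, x i ∈ maximalIdeal R) ∧
      ∀ q ∈ Module.support R M, (∀ j, x j ∈ q.asIdeal) → q.asIdeal = maximalIdeal R := by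
  have hsupp : ∀ q : PrimeSpectrum R,
      q ∈ Module.support R (M ⧸ Ideal.span (Set.range x) • (⊤ : Submodule R M)) ↔
        q ∈ Module.support R M ∧ ∀ j, x j ∈ q.asIdeal := by
    intro q
    rw [Module.support_quotient, PrimeSpectrum.zeroLocus_span]
    simp [Set.range_subset_iff]
  constructor
  · rintro ⟨h1, h2, h3⟩
    exact ⟨h1, h2, fun q hq h => asIdeal_eq_of_isFiniteLength h3 ((hsupp q).2 ⟨hq, h⟩)⟩
  · rintro ⟨h1, h2, h3⟩
    exact ⟨h1, h2, isFiniteLength_of_forall_asIdeal_eq fun q hq =>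
      h3 q ((hsupp q).1 hq).1 ((hsupp q).1 hq).2⟩

theorem exists_isGoodSystemOfParameters {d : ℕ} (hM : Module.supportDim R M = d) :
    ∃ x : Fin d → R, IsGoodSystemOfParameters M x := by
  classical
  obtain ⟨t, D, hD⟩ := exists_isDimensionFiltration hM
  choose n hn using fun i : Fin t => exists_annihilator_pow_smul_inf_eq_bot (D i.castSucc)
  -- A prime over `a j` contains Ann(D_i) for some i with dim D_i ≤ j, so its coheight is at most j,
  -- as the selection of parameters needs.
  let a : Fin d → Ideal R := fun j =>
    (Finset.univ.filter fun i : Fin t =>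
      Module.supportDim R (D i.castSucc) ≤ ((j : ℕ) : WithBot ℕ∞)).inf
      fun i => Module.annihilator R (D i.castSucc) ^ n i
  obtain ⟨x, hxa, hxm, hx⟩ := exists_parameters_mem d a (fun j q hq => by
    obtain ⟨i, hi, hle⟩ := q.isPrime.inf_le'.1 hq
    have := (coheight_le_supportDim (Module.mem_support_iff_of_finite.2
      (q.isPrime.le_of_pow_le hle))).trans (Finset.mem_filter.1 hi).2
    exact_mod_cast this) hM.le
  refine ⟨x, isSystemOfParameters_iff.2 ⟨hM, hxm, hx⟩, t, D, hD, fun i => ?_⟩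
  rw [eq_bot_iff, ← hn i, inf_comm]
  refine inf_le_inf_right _ (Submodule.smul_mono_left (Ideal.span_le.2 ?_))
  rintro _ ⟨j, hj, rfl⟩
  exact Finset.inf_le (f := fun i => Module.annihilator R (D i.castSucc) ^ n i)
    (Finset.mem_filter.2 ⟨Finset.mem_univ i, hj⟩) (hxa j)

end Parameters

end SeqCM

namespace SeqCM

open IsLocalRing RingTheory.Sequence

/-! ### Cohen–Macaulay quotients D/N and regularity of parameters. -/

section Quotient

variable {R : Type*} [CommRing R] {M : Type*} [AddCommGroup M] [Module R M]

theorem mk_mem_smul_top_iff {D N : Submodule R M} (hND : N ≤ D) (I : Ideal R) (y : D) :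
    (Submodule.Quotient.mk y : D ⧸ N.submoduleOf D) ∈ I • (⊤ : Submodule R (D ⧸ N.submoduleOf D)) ↔
      (y : M) ∈ I • D ⊔ N := by
  have h1 : I • (⊤ : Submodule R (D ⧸ N.submoduleOf D)) =
      Submodule.map (N.submoduleOf D).mkQ (I • ⊤) := by
    rw [Submodule.map_smul'', Submodule.map_top, Submodule.range_mkQ]
  have h2 : I • D ⊔ N = Submodule.map D.subtype (N.submoduleOf D ⊔ I • ⊤) := by
    rw [Submodule.map_sup, Submodule.map_smul'', Submodule.map_subtype_top, Submodule.submoduleOf,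
      Submodule.map_comap_subtype, inf_eq_right.2 hND, sup_comm]
  rw [h1, h2, ← Submodule.comap_map_mkQ]
  constructor
  · exact fun h => ⟨y, h, rfl⟩
  · rintro ⟨z, hz, hzy⟩
    obtain rfl : z = y := Subtype.ext hzy
    exact hz

theorem isSMulRegular_quotient_smul_top_iff {D N : Submodule R M} (hND : N ≤ D) (I : Ideal R)
    (r : R) : IsSMulRegular ((D ⧸ N.submoduleOf D) ⧸ I • (⊤ : Submodule R (D ⧸ N.submoduleOf D))) r ↔
      ∀ p ∈ D, r • p ∈ I • D ⊔ N → p ∈ I • D ⊔ N := by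
  rw [isSMulRegular_quotient_iff_mem_of_smul_mem,
    (Submodule.Quotient.mk_surjective (N.submoduleOf D)).forall]
  simp only [← Submodule.Quotient.mk_smul, mk_mem_smul_top_iff hND]
  exact ⟨fun h p hp => h ⟨p, hp⟩, fun h y => h y y.2⟩

theorem powIdeal_list {ι : Type*} (x : ι → R) (α : ι → ℕ) (L : List ι) :
    powIdeal x α {j | j ∈ L} = Ideal.ofList (L.map fun j => x j ^ α j) := by
  rw [powIdeal, Ideal.ofList]
  congr 1
  ext r
  simp

theorem RegularMod.isWeaklyRegular {ι : Type*} {x : ι → R} {D N : Submodule R M}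
    (h : RegularMod x D N) (hND : N ≤ D) {L : List ι} (hL : L.Nodup) :
    IsWeaklyRegular (D ⧸ N.submoduleOf D) (L.map x) := by
  rw [isWeaklyRegular_iff_Fin]
  intro i
  have hi : (i : ℕ) < L.length := by simpa using i.2
  have hnot : L[(i : ℕ)] ∉ {j | j ∈ L.take i} := by
    intro hmem
    obtain ⟨k, hk, hki⟩ := List.mem_iff_getElem.1 hmem
    rw [List.getElem_take] at hki
    have := (hL.getElem_inj_iff).1 hki
    rw [List.length_take] at hk
    omega
  have h1 := powIdeal_list x (fun _ => 1) (L.take i)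
  simp only [pow_one] at h1
  have hget : (L.map x)[i] = x L[(i : ℕ)] := by simp
  rw [← List.map_take, ← h1, hget, isSMulRegular_quotient_smul_top_iff hND]
  exact h _ _ hnot _ fun _ => le_rfl

end Quotient

section CohenMacaulay

universe u v

variable {R : Type u} [CommRing R] [IsLocalRing R] [IsNoetherianRing R]
  {M : Type v} [AddCommGroup M] [Module R M] [Module.Finite R M]

theorem length_le_supportDim {rs : List R} (hreg : IsRegular M rs) :
    (rs.length : WithBot ℕ∞) ≤ Module.supportDim R M := by
  rw [← Module.supportDim_add_length_eq_supportDim_of_isRegular rs hreg]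
  have hnt := hreg.quot_ofList_smul_nontrivial ⊤
  obtain ⟨c, hc⟩ := WithBot.ne_bot_iff_exists.1 (Module.supportDim_ne_bot_of_nontrivial R
    (M ⧸ Ideal.ofList rs • (⊤ : Submodule R M)))
  rw [← hc]
  exact_mod_cast le_add_self (a := (rs.length : ℕ∞)) (b := c)

theorem depth_le_supportDim [Nontrivial M] : (depth R M : WithBot ℕ∞) ≤ Module.supportDim R M := by
  obtain ⟨c, hc⟩ := WithBot.ne_bot_iff_exists.1 (Module.supportDim_ne_bot_of_nontrivial R M)
  rw [← hc]
  refine WithBot.coe_le_coe.2 (iSup_le fun rs => ?_)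
  have := length_le_supportDim rs.2.2
  rw [← hc] at this
  exact_mod_cast this

/-- The supremum defining depth is attained: some regular sequence is longer than e - 1, and none
exceeds the dimension e. -/
theorem exists_isRegular_of_depth_eq [Nontrivial M] {e : ℕ} (hdim : Module.supportDim R M = e)
    (hdepth : depth R M = e) : ∃ rs : List R, rs.length = e ∧ (∀ r ∈ rs, r ∈ maximalIdeal R) ∧
      IsRegular M rs := by
  rcases Nat.eq_zero_or_pos e with rfl | he
  · exact ⟨[], rfl, by simp, IsRegular.nil R M⟩
  have hlt : ((e - 1 : ℕ) : ℕ∞) < depth R M := by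
    rw [hdepth]
    exact_mod_cast Nat.sub_lt he one_pos
  obtain ⟨⟨rs, hmem, hrs⟩, hlen⟩ := lt_iSup_iff.1 hlt
  refine ⟨rs, le_antisymm ?_ ?_, hmem, hrs⟩
  · have := length_le_supportDim hrs
    rw [hdim] at this
    exact_mod_cast this
  · have : e - 1 < rs.length := by exact_mod_cast hlen
    omega

variable {κ : Type*} [Fintype κ] {x : κ → R} {D N : Submodule R M}

omit [IsLocalRing R] in
theorem supportDim_quotient_of_isGreatest
    (hN : IsGreatest {L : Submodule R M | L ≤ D ∧
      Module.supportDim R L < Module.supportDim R D} N) :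
    Nontrivial (D ⧸ N.submoduleOf D) ∧
      Module.supportDim R (D ⧸ N.submoduleOf D) = Module.supportDim R D := by
  have hnt : Nontrivial (D ⧸ N.submoduleOf D) := by
    rw [Submodule.Quotient.nontrivial_iff, Ne, Submodule.submoduleOf_eq_top]
    intro hDN
    exact hN.1.2.ne (by rw [le_antisymm hN.1.1 hDN])
  refine ⟨hnt, le_antisymm (Module.supportDim_le_of_surjective _ (Submodule.mkQ_surjective _)) ?_⟩
  obtain ⟨p, hp⟩ := associatedPrimes.nonempty R (D ⧸ N.submoduleOf D)
  exact (supportDim_le_coheight_of_isGreatest hN (p := ⟨p, hp.isPrime⟩) hp).trans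
    (coheight_le_supportDim (mem_support_of_isAssociatedPrime hp))

/-- Were x_i in an associated prime P of D/N, the other parameters would bound dim R/P by dim D - 1,
against unmixedness. -/
theorem mem_of_smul_mem_of_isGreatest
    (hN : IsGreatest {L : Submodule R M | L ≤ D ∧
      Module.supportDim R L < Module.supportDim R D} N)
    (hx : ∀ j, x j ∈ maximalIdeal R) (hcard : Module.supportDim R D = Fintype.card κ)
    (hpar : ∀ q ∈ Module.support R D, (∀ j, x j ∈ q.asIdeal) → q.asIdeal = maximalIdeal R)
    (i : κ) (p : M) (hp : p ∈ D) (hxp : x i • p ∈ N) : p ∈ N := by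
  classical
  have hreg : IsSMulRegular (D ⧸ N.submoduleOf D) (x i) := by
    by_contra hcon
    obtain ⟨P, hP, hxP⟩ := exists_isAssociatedPrime_mem_of_not_isSMulRegular hcon
    have h1 := supportDim_le_coheight_of_isGreatest hN hP
    have h2 := coheight_le_length P ((Finset.univ.erase i).toList.map x)
      (fun r hr => by obtain ⟨j, -, rfl⟩ := List.mem_map.1 hr; exact hx j) fun q hPq hq => by
        refine hpar q (Module.support_subset_of_surjective _ (Submodule.mkQ_surjective _)
          (Module.mem_support_mono hPq (mem_support_of_isAssociatedPrime hP))) fun j => ?_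
        by_cases hj : j = i
        · exact hj ▸ hPq hxP
        · exact hq _ (List.mem_map.2 ⟨j, by simpa using hj, rfl⟩)
    rw [hcard] at h1
    have h3 : (Fintype.card κ : ℕ∞) ≤ Order.coheight P := by exact_mod_cast h1
    have h4 := h3.trans h2
    rw [List.length_map, Finset.length_toList, Finset.card_erase_of_mem (Finset.mem_univ i),
      Finset.card_univ] at h4
    have h5 : Fintype.card κ ≤ Fintype.card κ - 1 := by exact_mod_cast h4
    have := Fintype.card_pos_iff.2 ⟨i⟩
    omega
  exact (isSMulRegular_quotient_iff_mem_of_smul_mem _ _).1 hreg ⟨p, hp⟩ hxp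

theorem regularMod_of_isCohenMacaulay
    (hN : IsGreatest {L : Submodule R M | L ≤ D ∧
      Module.supportDim R L < Module.supportDim R D} N)
    (hx : ∀ j, x j ∈ maximalIdeal R) (hcard : Module.supportDim R D = Fintype.card κ)
    (hpar : ∀ q ∈ Module.support R D, (∀ j, x j ∈ q.asIdeal) → q.asIdeal = maximalIdeal R)
    (hCM : IsCohenMacaulay R (D ⧸ N.submoduleOf D)) : RegularMod x D N := by
  classical
  obtain ⟨hnt, hdim⟩ := supportDim_quotient_of_isGreatest hN
  have hdepth := hCM.resolve_left (not_subsingleton_iff_nontrivial.2 hnt)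
  rw [hdim, hcard] at hdepth
  obtain ⟨ss, hlen, hmem, hss⟩ := exists_isRegular_of_depth_eq (hdim.trans hcard)
    (by exact_mod_cast hdepth)
  intro T i hi α hα p hp hxp
  -- Powers α on T and exponent 1 elsewhere still give parameters. Listing T first, then i, then the
  -- rest turns weak regularity into the required statement at i.
  set f : κ → R := fun j => x j ^ (if j ∈ T then α j else 1) with hf
  set S : Finset κ := Finset.univ.filter (· ∈ T) with hS
  have hiS : i ∉ S := by simpa [hS] using hi
  have hreg := isWeaklyRegular_of_parameters (M := D ⧸ N.submoduleOf D)
    (S.toList.map f ++ f i :: (Finset.univ \ insert i S).toList.map f)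
    (by
      have hfm : ∀ j, f j ∈ maximalIdeal R := fun j => Ideal.pow_mem_of_mem _ (hx j) _ (by
        have := hα j
        split_ifs <;> omega)
      intro r hr
      simp only [List.mem_append, List.mem_map, List.mem_cons] at hr
      rcases hr with ⟨j, -, rfl⟩ | rfl | ⟨j, -, rfl⟩ <;> exact hfm _)
    (fun q hq hqr => hpar q
      (Module.support_subset_of_surjective _ (Submodule.mkQ_surjective _) hq) fun j => by
        suffices f j ∈ q.asIdeal from q.isPrime.mem_of_pow_mem _ this
        refine hqr _ ?_
        simp only [List.mem_append, List.mem_map, List.mem_cons, Finset.mem_toList]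
        by_cases hjS : j ∈ S
        · exact Or.inl ⟨j, hjS, rfl⟩
        by_cases hji : j = i
        · exact Or.inr (Or.inl (by rw [hji]))
        · exact Or.inr (Or.inr ⟨j, by simp [hjS, hji], rfl⟩))
    ⟨ss, by
      have hle : (insert i S).card ≤ Fintype.card κ := Finset.card_le_univ _
      rw [Finset.card_insert_of_notMem hiS] at hle
      rw [hlen, List.length_append, List.length_cons, List.length_map, List.length_map,
        Finset.length_toList, Finset.length_toList, Finset.card_sdiff_of_subset
        (Finset.subset_univ _), Finset.card_univ, Finset.card_insert_of_notMem hiS]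
      omega, hmem, hss⟩
  obtain ⟨-, hreg⟩ := (isWeaklyRegular_append_iff _ _ _).1 hreg
  obtain ⟨hreg, -⟩ := (isWeaklyRegular_cons_iff _ _ _).1 hreg
  have hideal : Ideal.ofList (S.toList.map f) = powIdeal x α T := by
    have := powIdeal_list x (fun j => if j ∈ T then α j else 1) S.toList
    rw [hf, ← this]
    have hset : {j | j ∈ S.toList} = T := by ext j; simp [hS]
    rw [hset]
    exact powIdeal_congr x fun j hj => by simp [hj]
  have hfi : f i = x i := by simp [hf, hi]
  rw [hideal, hfi, isSMulRegular_quotient_smul_top_iff hN.1.1] at hreg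
  exact hreg p hp hxp

theorem RegularMod.isCohenMacaulay (h : RegularMod x D N)
    (hN : IsGreatest {L : Submodule R M | L ≤ D ∧
      Module.supportDim R L < Module.supportDim R D} N)
    (hx : ∀ j, x j ∈ maximalIdeal R) (hcard : Module.supportDim R D = Fintype.card κ) :
    IsCohenMacaulay R (D ⧸ N.submoduleOf D) := by
  obtain ⟨hnt, hdim⟩ := supportDim_quotient_of_isGreatest hN
  have hmem : ∀ r ∈ (Finset.univ : Finset κ).toList.map x, r ∈ maximalIdeal R := by
    intro r hr
    obtain ⟨j, -, rfl⟩ := List.mem_map.1 hr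
    exact hx j
  have hreg := IsRegular.of_isWeaklyRegular_of_mem_maximalIdeal _ hmem
    (h.isWeaklyRegular hN.1.1 (Finset.nodup_toList Finset.univ))
  refine Or.inr (le_antisymm depth_le_supportDim ?_)
  rw [hdim, hcard]
  have : (Fintype.card κ : ℕ∞) ≤ depth R (D ⧸ N.submoduleOf D) := by
    refine le_trans (le_of_eq ?_) (le_iSup (fun rs : {rs : List R // (∀ r ∈ rs, r ∈ maximalIdeal R) ∧
      IsRegular (D ⧸ N.submoduleOf D) rs} => (rs.1.length : ℕ∞)) ⟨_, hmem, hreg⟩)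
    simp
  exact_mod_cast this

end CohenMacaulay

end SeqCM

namespace SeqCM

open IsLocalRing

/-! ### Steps of the filtration for a good system of parameters. -/

section Good

universe u v

variable {R : Type u} [CommRing R] {M : Type v} [AddCommGroup M] [Module R M] {d : ℕ}
  {x : Fin d → R}

theorem hasParametricDecomposition_iff :
    HasParametricDecomposition M x ↔ ParametricOn x (⊤ : Submodule R M) := by
  have hspan : ∀ α : Fin d → ℕ, Ideal.span (Set.range fun i => x i ^ α i) =
      powIdeal x α Set.univ := fun α => by rw [powIdeal, Set.image_univ]
  simp only [HasParametricDecomposition, hspan]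
  constructor
  · intro h n hn p hp
    rw [h n hn]
    simp only [Submodule.mem_iInf]
    exact fun α hα => hp α hα.1 (by simpa using hα.2)
  · intro h n hn
    refine le_antisymm (le_iInf₂ fun α hα => ?_) fun p hp => ?_
    · exact span_pow_smul_le_powIdeal_smul x ⊤ (by simpa using hα.2)
    · simp only [Submodule.mem_iInf] at hp
      exact h n hn p fun α h1 h2 => hp α ⟨h1, by simpa using h2⟩

/-- A submodule killed by a nonempty family has the parametric decomposition. -/
theorem parametricOn_of_smul_eq_zero {D : Submodule R M} (hd : 1 ≤ d)
    (h : ∀ j, ∀ m ∈ D, x j • m = 0) : ParametricOn x D := by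
  intro n hn p hp
  have hmem := hp (fun k => 1 + (Pi.single ⟨0, hd⟩ (n - 1) : Fin d → ℕ) k) (fun _ => by omega) (by
    rw [Finset.sum_add_distrib]
    simp
    omega)
  have hle : Ideal.span (Set.range x) ≤ D.annihilator := by
    refine Ideal.span_le.2 ?_
    rintro _ ⟨j, rfl⟩
    exact Submodule.mem_annihilator.2 (h j)
  have hbot : powIdeal x (fun k => 1 + (Pi.single ⟨0, hd⟩ (n - 1) : Fin d → ℕ) k) Set.univ • D ≤
      ⊥ := by
    refine (Submodule.smul_mono_left ((powIdeal_le_of_le x (α := fun _ => 1)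
      fun k _ => Nat.le_add_right _ _).trans ?_)).trans (Submodule.annihilator_smul D).le
    rwa [powIdeal_univ_one]
  rw [(Submodule.mem_bot R).1 (hbot hmem)]
  exact zero_mem _

variable [IsLocalRing R] {t : ℕ} {D : Fin (t + 1) → Submodule R M}

/-- The product x_j m lies both in D_s and in the submodule that goodness makes meet it trivially.
For D_t = M no index j < d is large enough. -/
theorem IsDimensionFiltration.smul_eq_zero (hD : IsDimensionFiltration R D)
    (hM : Module.supportDim R M = d)
    (hgood : ∀ i : Fin t, D i.castSucc ⊓ Ideal.span (x '' {j : Fin d |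
      Module.supportDim R (D i.castSucc) ≤ ((j : ℕ) : WithBot ℕ∞)}) • (⊤ : Submodule R M) = ⊥)
    {s : Fin (t + 1)} {j : Fin d}
    (hj : Module.supportDim R (D s) ≤ ((j : ℕ) : WithBot ℕ∞)) : ∀ m ∈ D s, x j • m = 0 := by
  intro m hm
  induction s using Fin.lastCases with
  | last =>
    rw [hD.top, Module.supportDim_eq_of_equiv Submodule.topEquiv, hM] at hj
    have : d ≤ (j : ℕ) := by exact_mod_cast hj
    omega
  | cast i =>
    have : x j • m ∈ D i.castSucc ⊓ Ideal.span (x '' {j : Fin d |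
        Module.supportDim R (D i.castSucc) ≤ ((j : ℕ) : WithBot ℕ∞)}) • (⊤ : Submodule R M) :=
      ⟨Submodule.smul_mem _ _ hm,
        Submodule.smul_mem_smul (Ideal.subset_span ⟨j, hj, rfl⟩) Submodule.mem_top⟩
    rwa [hgood i] at this

variable [IsNoetherianRing R] [Module.Finite R M]

theorem IsDimensionFiltration.exists_supportDim_succ_eq (hD : IsDimensionFiltration R D)
    (hM : Module.supportDim R M = d) (i : Fin t) :
    ∃ e : ℕ, e < d ∧ Module.supportDim R (D i.succ) = (e + 1 : ℕ) := by
  have hle : Module.supportDim R (D i.succ) ≤ (d : WithBot ℕ∞) := by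
    rw [← hM]
    exact Module.supportDim_le_of_injective _ (Submodule.injective_subtype _)
  have hpos : ¬ Module.supportDim R (D i.succ) ≤ 0 := by
    intro h
    have h1 := le_localH0_of_supportDim_le h
    rw [← hD.bottom] at h1
    exact absurd (hD.strictMono (Fin.succ_pos i)) (not_lt_of_ge h1)
  obtain ⟨c, hc⟩ := WithBot.ne_bot_iff_exists.1
    (fun h => hpos (h ▸ bot_le) : Module.supportDim R (D i.succ) ≠ ⊥)
  rw [← hc] at hle hpos
  have hle' : c ≤ (d : ℕ∞) := by exact_mod_cast hle
  obtain ⟨e, rfl⟩ := ENat.ne_top_iff_exists.1 (ne_top_of_le_ne_top (ENat.natCast_ne_top d) hle')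
  have h1 : e ≤ d := by exact_mod_cast hle'
  have h2 : e ≠ 0 := by
    rintro rfl
    exact hpos le_rfl
  obtain ⟨e, rfl⟩ := Nat.exists_eq_succ_of_ne_zero h2
  exact ⟨e, h1, hc.symm⟩

/-- The parameters whose index lies below the dimension of `D i.succ` are parameters of it, the
others kill it, and the last of the former kills `D i.castSucc`. -/
theorem IsDimensionFiltration.subfamily (hD : IsDimensionFiltration R D)
    (hx : IsSystemOfParameters M x)
    (hgood : ∀ i : Fin t, D i.castSucc ⊓ Ideal.span (x '' {j : Fin d |
      Module.supportDim R (D i.castSucc) ≤ ((j : ℕ) : WithBot ℕ∞)}) • (⊤ : Submodule R M) = ⊥)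
    (i : Fin t) :
    ∃ e : ℕ, Module.supportDim R (D i.succ) = Fintype.card {j : Fin d // (j : ℕ) ≤ e} ∧
      (∀ j : Fin d, ¬ (j : ℕ) ≤ e → ∀ m ∈ D i.succ, x j • m = 0) ∧
      (∀ q ∈ Module.support R (D i.succ), (∀ j : {j : Fin d // (j : ℕ) ≤ e}, x j ∈ q.asIdeal) →
        q.asIdeal = maximalIdeal R) ∧
      ∃ j : {j : Fin d // (j : ℕ) ≤ e}, ∀ m ∈ D i.castSucc, x j • m = 0 := by
  obtain ⟨hM, -, hpar⟩ := isSystemOfParameters_iff.1 hx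
  obtain ⟨e, hed, he⟩ := hD.exists_supportDim_succ_eq hM i
  have hkill : ∀ j : Fin d, ¬ (j : ℕ) ≤ e → ∀ m ∈ D i.succ, x j • m = 0 := fun j hj => by
    refine hD.smul_eq_zero hM hgood ?_
    rw [he]
    exact_mod_cast not_le.1 hj
  refine ⟨e, ?_, hkill, fun q hq h => ?_, ⟨⟨e, hed⟩, le_rfl⟩, ?_⟩
  · rw [he, Fintype.card_subtype]
    congr 2
    have : (Finset.univ.filter fun j : Fin d => (j : ℕ) ≤ e) = Finset.Iic ⟨e, hed⟩ := by
      ext j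
      simp [Fin.le_def]
    rw [this, Fin.card_Iic]
  · refine hpar q (Module.support_subset_of_injective _ (Submodule.injective_subtype _) hq)
      fun j => ?_
    by_cases hj : (j : ℕ) ≤ e
    · exact h ⟨j, hj⟩
    · exact Module.annihilator_le_of_mem_support hq
        (Module.mem_annihilator.2 fun m => Subtype.ext (hkill j hj m m.2))
  · refine hD.smul_eq_zero hM hgood ?_
    have := (hD.step i).1.2
    rw [he, Nat.cast_succ] at this
    exact ENat.WithBot.lt_add_one_iff.1 this

/-- Parametric decomposition ascends along a filtration with Cohen–Macaulay quotients. -/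
theorem parametricOn_of_isCohenMacaulay (hd : 1 ≤ d) (hD : IsDimensionFiltration R D)
    (hx : IsSystemOfParameters M x)
    (hgood : ∀ i : Fin t, D i.castSucc ⊓ Ideal.span (x '' {j : Fin d |
      Module.supportDim R (D i.castSucc) ≤ ((j : ℕ) : WithBot ℕ∞)}) • (⊤ : Submodule R M) = ⊥)
    (hCM : ∀ i : Fin t, IsCohenMacaulay R (D i.succ ⧸ (D i.castSucc).submoduleOf (D i.succ)))
    (s : Fin (t + 1)) : ParametricOn x (D s) := by
  induction s using Fin.induction with
  | zero =>
    refine parametricOn_of_smul_eq_zero hd fun j => hD.smul_eq_zero hx.dim_eq hgood ?_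
    rw [hD.bottom]
    exact supportDim_localH0_le.trans (by exact_mod_cast Nat.zero_le _)
  | succ i ih =>
    obtain ⟨e, hcard, hkill, hpar, j, -⟩ := hD.subfamily hx hgood i
    have : Nonempty {j : Fin d // (j : ℕ) ≤ e} := ⟨j⟩
    have hND := (hD.step i).1.1
    have hreg := regularMod_of_isCohenMacaulay (x := fun j : {j : Fin d // (j : ℕ) ≤ e} => x j)
      (hD.step i) (fun j => hx.mem j) hcard hpar (hCM i)
    rw [← parametricOn_subtype_iff (P := fun j : Fin d => (j : ℕ) ≤ e)
      fun j hj m hm => hkill j hj m (hND hm)] at ih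
    rw [← parametricOn_subtype_iff hkill]
    exact ih.of_submodule hreg hND

/-- Parametric decomposition descends along the filtration and makes the quotients
Cohen–Macaulay. -/
theorem isCohenMacaulay_and_parametricOn_castSucc (hD : IsDimensionFiltration R D)
    (hx : IsSystemOfParameters M x)
    (hgood : ∀ i : Fin t, D i.castSucc ⊓ Ideal.span (x '' {j : Fin d |
      Module.supportDim R (D i.castSucc) ≤ ((j : ℕ) : WithBot ℕ∞)}) • (⊤ : Submodule R M) = ⊥)
    (i : Fin t) (h : ParametricOn x (D i.succ)) :
    IsCohenMacaulay R (D i.succ ⧸ (D i.castSucc).submoduleOf (D i.succ)) ∧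
      ParametricOn x (D i.castSucc) := by
  obtain ⟨e, hcard, hkill, hpar, j, hj⟩ := hD.subfamily hx hgood i
  have : Nonempty {j : Fin d // (j : ℕ) ≤ e} := ⟨j⟩
  have hND := (hD.step i).1.1
  rw [← parametricOn_subtype_iff hkill] at h
  have hq := h.quasiRegularMod (fun j => hx.mem j) hj
    (mem_of_smul_mem_of_isGreatest (hD.step i) (fun j => hx.mem j) hcard hpar)
  refine ⟨(hq.regularMod fun j => hx.mem j).isCohenMacaulay (hD.step i) (fun j => hx.mem j) hcard,
    ?_⟩
  rw [← parametricOn_subtype_iff (P := fun j : Fin d => (j : ℕ) ≤ e)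
    fun j hj m hm => hkill j hj m (hND hm)]
  exact hq.parametricOn_submodule (fun j => hx.mem j) hND h

theorem IsSequentiallyCohenMacaulay.hasParametricDecomposition (hd : 1 ≤ d)
    (h : IsSequentiallyCohenMacaulay R M) (hx : IsGoodSystemOfParameters M x) :
    HasParametricDecomposition M x := by
  obtain ⟨t, D, hD, hCM⟩ := h
  obtain ⟨hsop, t', D', hD', hgood⟩ := hx
  -- The filtrations witnessing the two hypotheses may be indexed differently; uniqueness of
  -- consecutive pairs transfers the Cohen–Macaulay property.
  have := parametricOn_of_isCohenMacaulay hd hD' hsop hgood (fun i => by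
    obtain ⟨j, h1, h2⟩ := hD.exists_eq hD' i
    rw [h1, h2]
    exact hCM j) (Fin.last t')
  rwa [hD'.top, ← hasParametricDecomposition_iff] at this

theorem IsGoodSystemOfParameters.isSequentiallyCohenMacaulay (hx : IsGoodSystemOfParameters M x)
    (h : HasParametricDecomposition M x) : IsSequentiallyCohenMacaulay R M := by
  obtain ⟨hsop, t, D, hD, hgood⟩ := hx
  have key : ∀ s, ParametricOn x (D s) := by
    intro s
    induction s using Fin.reverseInduction with
    | last => rwa [hD.top, ← hasParametricDecomposition_iff]
    | cast i ih => exact (isCohenMacaulay_and_parametricOn_castSucc hD hsop hgood i ih).2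
  exact ⟨t, D, hD, fun i => (isCohenMacaulay_and_parametricOn_castSucc hD hsop hgood i (key _)).1⟩

end Good

end SeqCM

theorem theorem1p1 {R : Type*} [CommRing R] [IsLocalRing R] [IsNoetherianRing R]
    {M : Type*} [AddCommGroup M] [Module R M] [Module.Finite R M]
    (d : ℕ) (hd : 1 ≤ d) (hM : Module.supportDim R M = d) :
    List.TFAE
      [SeqCM.IsSequentiallyCohenMacaulay R M,
       ∀ x : Fin d → R, SeqCM.IsGoodSystemOfParameters M x → SeqCM.HasParametricDecomposition M x,
       ∃ x : Fin d → R, SeqCM.IsGoodSystemOfParameters M x ∧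
         SeqCM.HasParametricDecomposition M x] := by
  tfae_have 1 → 2 := fun h x hx => h.hasParametricDecomposition hd hx
  tfae_have 2 → 3 := fun h => by
    obtain ⟨x, hx⟩ := SeqCM.exists_isGoodSystemOfParameters hM
    exact ⟨x, hx, h x hx⟩
  tfae_have 3 → 1 := fun ⟨x, hx, h⟩ => hx.isSequentiallyCohenMacaulay h
  tfae_finish
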